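/- **Setting.** Let $F(x)=\frac1n\sum_{i=1}^n f_i(x)$ on $\mathbb R^d$ ($n,d\ge 1$), with every $f_i$ twice differentiable and $\sup_x\|\nabla^2 f_i(x)\|\le K_i$ (spectral norm). Put $K_{\max}=\max_i K_i$ and $\widehat K=\frac1n\sum_i K_i$. Fix $\eta\in(0,1)$, $\gamma>1$, $\nu\in(0,1]$, $L,K_H,\sigma_0>0$, a starting point $x_0$, and $\Delta$ with $F(x_0)-\inf F\le\Delta$. **Algorithm (adaptive cubic regularization, ARC).** For $t=0,1,\dots$: draw a fresh sample $\mathcal S_t$ of $|\mathcal S|\ge1$ indices from a distribution $(p_i)$ on $\{1,\dots,n\}$ and form $$H_t=\frac1{n|\mathcal S|}\sum_{j\in\mathcal S_t}\frac1{p_j}\nabla^2 f_j(x_t).$$ If $\|\nabla F(x_t)\|\le\epsilon_g$ and $\lambda_{\min}(H_t)\ge-\epsilon_H$, return $x_t$. Otherwise find an approximate minimizer $s_t$ of $m_t(s)=\langle\nabla F(x_t),s\rangle+\frac12\langle s,H_ts\rangle+\frac{\sigma_t}3\|s\|^3$ and let $\rho_t=\frac{F(x_t)-F(x_t+s_t)}{-m_t(s_t)}$.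 If $\rho_t\ge\eta$, set $x_{t+1}=x_t+s_t$, $\sigma_{t+1}=\sigma_t/\gamma$; otherwise set $x_{t+1}=x_t$, $\sigma_{t+1}=\gamma\sigma_t$. **Assumptions along the run, before termination.** 1. $\|\nabla^2F(y)-\nabla^2F(x_t)\|\le L\|y-x_t\|$ for $y\in[x_t,x_t+s_t]$. 2. With $g_t=\nabla F(x_t)$, there is $s_t^C=-\alpha g_t$, $\alpha\ge0$, with $$-m_t(s_t)\ge-m_t(s_t^C)\ge\max\Big\{\tfrac1{12}\|s_t^C\|^2\big(\sqrt{K_H^2+4\sigma_t\|g_t\|}-K_H\big),\ \tfrac{\|g_t\|}{2\sqrt3}\min\big\{\tfrac{\|g_t\|}{K_H},\sqrt{\tfrac{\|g_t\|}{\sigma_t}}\big\}\Big\},$$ and, if $\lambda_{\min}(H_t)<0$, there is $s_t^E$ with $\langle s_t^E,H_ts_t^E\rangle\le\nu\lambda_{\min}(H_t)\|s_t^E\|^2<0$ and $$-m_t(s_t)\ge-m_t(s_t^E)\ge\tfrac{\nu|\lambda_{\min}(H_t)|}6\max\Big\{\|s_t^E\|^2,\tfrac{\nu^2|\lambda_{\min}(H_t)|^2}{\sigma_t^2}\Big\}.$$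 **Sampling.** Given a tolerance $\epsilon$ and a per-iteration failure probability $\delta_0$, one of the following holds. * Uniform: $p_i=1/n$, sampling with or without replacement, $K_{\max}\le K_H$, and $|\mathcal S|\ge\frac{16K_{\max}^2}{\epsilon^2}\log\frac{2d}{\delta_0}$. * Non-uniform: $f_i(x)=h_i(a_i^Tx)$ with $h_i:\mathbb R\to\mathbb R$, sampling with replacement from $p_i=\frac{|h_i''(a_i^Tx_t)|\|a_i\|^2}{\sum_j|h_j''(a_j^Tx_t)|\|a_j\|^2}$ (uniform if the denominator is $0$), $\widehat K\le K_H$, and $|\mathcal S|\ge\frac{4\widehat K^2}{\epsilon^2}\log\frac{2d}{\delta_0}$. **Theorem.** There is a constant $C\ge1$, depending only on $\eta,\gamma,\nu,L,K_H,\sigma_0,\Delta$, such that the following holds for all $\epsilon_g,\epsilon_H,\delta\in(0,1)$ and all $$0<\epsilon\le\min\Big\{\min\{\tfrac1{12},\tfrac{1-\eta}6\}\big(\sqrt{K_H^2+8L\epsilon_g}-K_H\big),\ \min\{\tfrac16,\tfrac{1-\eta}3\}\,\nu\,\epsilon_H\Big\}.$$ Consider the event that ARC terminates within $C\max\{\epsilon_g^{-2},\epsilon_H^{-3}\}$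 iterations and returns a point $x$ with $\|\nabla F(x)\|\le\epsilon_g$ and $\lambda_{\min}(\nabla^2F(x))\ge-(\epsilon+\epsilon_H)$. * If $\delta_0=\delta\min\{\epsilon_g^2,\epsilon_H^3\}$, this event has probability at least $1-C\delta$. * If $\delta_0=\frac{\delta}{C}\min\{\epsilon_g^2,\epsilon_H^3\}$, i.e. $\delta$ divided by the iteration bound, it has probability at least $1-\delta$. -/

import Mathlib

open MeasureTheory ProbabilityTheory
open scoped BigOperators

noncomputable section

namespace SubsampledARC

/-- `ℝ^d` with the Euclidean norm. -/
abbrev Vec (d : ℕ) := EuclideanSpace ℝ (Fin d)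

/-- The Hessian `∇²F(x)`, as a linear operator (the derivative of the gradient map). Its norm
is the spectral norm. -/
def hess {d : ℕ} (F : Vec d → ℝ) (x : Vec d) : Vec d →L[ℝ] Vec d :=
  fderiv ℝ (gradient F) x

/-- Twice differentiable on the whole space. -/
def TwiceDifferentiable {d : ℕ} (F : Vec d → ℝ) : Prop :=
  Differentiable ℝ F ∧ Differentiable ℝ (gradient F)

/-- The smallest eigenvalue of a symmetric operator, as the minimum of the Rayleigh quotient
`⟨v, A v⟩ / ‖v‖²`; see `isLeast_lambdaMin`. -/
def lambdaMin {d : ℕ} (A : Vec d →L[ℝ] Vec d) : ℝ :=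
  ⨅ v : {v : Vec d // v ≠ 0}, A.rayleighQuotient v

/-- For symmetric `A`, `lambdaMin A` is indeed the least eigenvalue. -/
theorem isLeast_lambdaMin {d : ℕ} (hd : 0 < d) (A : Vec d →L[ℝ] Vec d)
    (hA : (A : Vec d →ₗ[ℝ] Vec d).IsSymmetric) :
    IsLeast {c : ℝ | Module.End.HasEigenvalue (A : Vec d →ₗ[ℝ] Vec d) c} (lambdaMin A) := by
  have : Nonempty (Fin d) := ⟨⟨0, hd⟩⟩
  have : Nontrivial (Vec d) := inferInstance
  constructor
  · exact hA.hasEigenvalue_iInf_of_finiteDimensional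
  · intro c hc
    obtain ⟨v, hv⟩ := hc.exists_hasEigenvector
    have hv0 : v ≠ 0 := hv.2
    have hbdd : BddBelow (Set.range fun v : {v : Vec d // v ≠ 0} => A.rayleighQuotient v) := by
      refine ⟨-‖A‖, ?_⟩
      rintro _ ⟨w, rfl⟩
      have hw : 0 < ‖(w : Vec d)‖ ^ 2 := by
        have := norm_pos_iff.2 w.2
        positivity
      have h1 : |inner ℝ (A w) (w : Vec d)| ≤ ‖A‖ * ‖(w : Vec d)‖ ^ 2 := by
        refine (abs_real_inner_le_norm _ _).trans ?_
        nlinarith [A.le_opNorm (w : Vec d), norm_nonneg (w : Vec d)]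
      simp only [ContinuousLinearMap.rayleighQuotient, ContinuousLinearMap.reApplyInnerSelf_apply,
        RCLike.re_to_real]
      rw [le_div_iff₀ hw]
      linarith [neg_le_of_abs_le h1]
    have hq : A.rayleighQuotient v = c := by
      have hAv : A v = c • v := hv.apply_eq_smul
      have hn : ‖v‖ ^ 2 ≠ 0 := by simpa using hv0
      simp only [ContinuousLinearMap.rayleighQuotient, ContinuousLinearMap.reApplyInnerSelf_apply,
        RCLike.re_to_real, hAv, inner_smul_left, real_inner_self_eq_norm_sq]
      simp [hn]
    rw [← hq]
    exact ciInf_le hbdd ⟨v, hv0⟩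

/-! ### The deterministic part of the algorithm -/

/-- The cubic model `m(s) = ⟨g, s⟩ + ⟨s, H s⟩ / 2 + (σ / 3) ‖s‖³`. -/
def cubicModel {d : ℕ} (g : Vec d) (H : Vec d →L[ℝ] Vec d) (σ : ℝ) (s : Vec d) : ℝ :=
  inner ℝ g s + 1 / 2 * inner ℝ s (H s) + σ / 3 * ‖s‖ ^ 3

/-- Sufficient descent along Cauchy and eigen directions: the requirement on the approximate
minimizer `s` of the cubic model. The second clause is required only when `λ_min(H) < 0`. -/
def SufficientDescent {d : ℕ} (ν KH : ℝ) (g : Vec d) (H : Vec d →L[ℝ] Vec d) (σ : ℝ)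
    (s : Vec d) : Prop :=
  (∃ sC : Vec d, (∃ α : ℝ, 0 ≤ α ∧ sC = -(α • g)) ∧
    -cubicModel g H σ s ≥ -cubicModel g H σ sC ∧
    -cubicModel g H σ sC ≥
      max (1 / 12 * ‖sC‖ ^ 2 * (Real.sqrt (KH ^ 2 + 4 * σ * ‖g‖) - KH))
        (‖g‖ / (2 * Real.sqrt 3) * min (‖g‖ / KH) (Real.sqrt (‖g‖ / σ)))) ∧
  (lambdaMin H < 0 →
    ∃ sE : Vec d,
      inner ℝ sE (H sE) ≤ ν * lambdaMin H * ‖sE‖ ^ 2 ∧ ν * lambdaMin H * ‖sE‖ ^ 2 < 0 ∧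
      -cubicModel g H σ s ≥ -cubicModel g H σ sE ∧
      -cubicModel g H σ sE ≥
        ν * |lambdaMin H| / 6 * max (‖sE‖ ^ 2) (ν ^ 2 * |lambdaMin H| ^ 2 / σ ^ 2))

/-- The termination test at an iterate `x` with approximate Hessian `H`. -/
def Stops {d : ℕ} (F : Vec d → ℝ) (εg εH : ℝ) (x : Vec d) (H : Vec d →L[ℝ] Vec d) : Prop :=
  ‖gradient F x‖ ≤ εg ∧ -εH ≤ lambdaMin H

/-- The ratio `ρ` of actual to predicted decrease. -/
def decreaseRatio {d : ℕ} (F : Vec d → ℝ) (x : Vec d) (H : Vec d →L[ℝ] Vec d) (σ : ℝ)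
    (s : Vec d) : ℝ :=
  (F x - F (x + s)) / -cubicModel (gradient F x) H σ s

/-- A trajectory of adaptive cubic regularization with approximate Hessians `H t`, iterates
`x t`, regularization parameters `σ t` and trial steps `s t`. Nothing is required of the
sequences after the iteration at which the algorithm has returned. -/
structure IsARCRun {d : ℕ} (F : Vec d → ℝ) (εg εH η γ : ℝ) (x₀ : Vec d) (σ₀ : ℝ)
    (H : ℕ → Vec d →L[ℝ] Vec d) (x : ℕ → Vec d) (σ : ℕ → ℝ) (s : ℕ → Vec d) : Prop where
  x_zero : x 0 = x₀
  σ_zero : σ 0 = σ₀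
  accept : ∀ t, (∀ k ≤ t, ¬ Stops F εg εH (x k) (H k)) →
    η ≤ decreaseRatio F (x t) (H t) (σ t) (s t) →
      x (t + 1) = x t + s t ∧ σ (t + 1) = σ t / γ
  reject : ∀ t, (∀ k ≤ t, ¬ Stops F εg εH (x k) (H k)) →
    decreaseRatio F (x t) (H t) (σ t) (s t) < η →
      x (t + 1) = x t ∧ σ (t + 1) = γ * σ t

/-- Each trial step taken before termination satisfies the sufficient descent condition. -/
def StepsDescend {d : ℕ} (F : Vec d → ℝ) (εg εH ν KH : ℝ)
    (H : ℕ → Vec d →L[ℝ] Vec d) (x : ℕ → Vec d) (σ : ℕ → ℝ) (s : ℕ → Vec d) : Prop :=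
  ∀ t, (∀ k ≤ t, ¬ Stops F εg εH (x k) (H k)) →
    SufficientDescent ν KH (gradient F (x t)) (H t) (σ t) (s t)

/-- Lipschitz continuity of the Hessian along the piecewise linear path of the iterates:
`‖∇²F(y) - ∇²F(x_t)‖ ≤ L ‖y - x_t‖` for `y ∈ [x_t, x_t + s_t]`. -/
def HessianLipschitzOnPath {d : ℕ} (F : Vec d → ℝ) (εg εH L : ℝ)
    (H : ℕ → Vec d →L[ℝ] Vec d) (x : ℕ → Vec d) (s : ℕ → Vec d) : Prop :=
  ∀ t, (∀ k ≤ t, ¬ Stops F εg εH (x k) (H k)) →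
    ∀ y ∈ segment ℝ (x t) (x t + s t), ‖hess F y - hess F (x t)‖ ≤ L * ‖y - x t‖

/-- The largest Hessian tolerance allowed. -/
def maxTolerance (η ν L KH εg εH : ℝ) : ℝ :=
  min (min (1 / 12) ((1 - η) / 6) * (Real.sqrt (KH ^ 2 + 8 * L * εg) - KH))
    (min (1 / 6) ((1 - η) / 3) * ν * εH)

/-! ### Sub-sampling for finite sums -/

/-- `F(x) = (1/n) ∑ᵢ fᵢ(x)`. -/
def finiteSum {d n : ℕ} (f : Fin n → Vec d → ℝ) (x : Vec d) : ℝ :=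
  1 / (n : ℝ) * ∑ i, f i x

/-- The sub-sampled Hessian `(1 / (n |S|)) ∑_{j ∈ S} (1 / p_j) ∇²f_j(x)`, where the sample is the
list of indices `J`, possibly with repetitions. -/
def subsampledHess {d n m : ℕ} (f : Fin n → Vec d → ℝ) (p : Fin n → ℝ) (J : Fin m → Fin n)
    (x : Vec d) : Vec d →L[ℝ] Vec d :=
  (1 / ((n : ℝ) * (m : ℝ))) • ∑ k, (1 / p (J k)) • hess (f (J k)) x

/-- The uniform distribution on the indices. -/
def uniformWeights (n : ℕ) (_i : Fin n) : ℝ := 1 / (n : ℝ)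

/-- For `fᵢ(x) = gᵢ(⟨aᵢ, x⟩)`: the distribution
`pᵢ = |gᵢ''(⟨aᵢ, x⟩)| ‖aᵢ‖² / ∑ⱼ |gⱼ''(⟨aⱼ, x⟩)| ‖aⱼ‖²`. If the denominator vanishes (then all the
Hessians at `x` vanish and the formula says nothing), the uniform distribution is used. -/
def curvatureWeights {d n : ℕ} (a : Fin n → Vec d) (g : Fin n → ℝ → ℝ) (x : Vec d)
    (i : Fin n) : ℝ :=
  if ∑ j, |deriv (deriv (g j)) (inner ℝ (a j) x)| * ‖a j‖ ^ 2 = 0 then uniformWeights n i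
  else |deriv (deriv (g i)) (inner ℝ (a i) x)| * ‖a i‖ ^ 2 /
    ∑ j, |deriv (deriv (g j)) (inner ℝ (a j) x)| * ‖a j‖ ^ 2

/-- The probability of drawing the list `J` in independent draws from `p`. -/
def withReplacement {n : ℕ} (m : ℕ) (p : Fin n → ℝ) (J : Fin m → Fin n) : ℝ :=
  ∏ k, p (J k)

open Classical in
/-- The probability of drawing the list `J` in uniform draws without replacement. -/
def withoutReplacement (n m : ℕ) (J : Fin m → Fin n) : ℝ :=
  if Function.Injective J then 1 / (n.descFactorial m : ℝ) else 0

/-- Uniform sampling with or without replacement, with sample size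
`m ≥ (16 K_max² / ε²) log (2d / δ₀)`; here `K_H` is a bound with `K_max ≤ K_H`.
`p x` are the weights used at the point `x`, and `law x J` is the probability of the sample `J`. -/
def IsUniformSampling {d n : ℕ} (m : ℕ) (K : Fin n → ℝ) (KH ε δ₀ : ℝ)
    (p : Vec d → Fin n → ℝ) (law : Vec d → (Fin m → Fin n) → ℝ) : Prop :=
  (∀ x, p x = uniformWeights n) ∧
  ((∀ x, law x = withReplacement m (uniformWeights n)) ∨
    (m ≤ n ∧ ∀ x, law x = withoutReplacement n m)) ∧
  (⨆ i, K i) ≤ KH ∧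
  16 * (⨆ i, K i) ^ 2 / ε ^ 2 * Real.log (2 * d / δ₀) ≤ m

/-- Non-uniform sampling for `fᵢ(x) = gᵢ(⟨aᵢ, x⟩)`, with sample size
`m ≥ (4 K̂² / ε²) log (2d / δ₀)`, `K̂ = (1/n) ∑ᵢ Kᵢ`; here `K_H` is a bound with `K̂ ≤ K_H`. -/
def IsNonuniformSampling {d n : ℕ} (m : ℕ) (f : Fin n → Vec d → ℝ) (K : Fin n → ℝ)
    (KH ε δ₀ : ℝ) (p : Vec d → Fin n → ℝ) (law : Vec d → (Fin m → Fin n) → ℝ) : Prop :=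
  ∃ (a : Fin n → Vec d) (g : Fin n → ℝ → ℝ),
    (∀ i x, f i x = g i (inner ℝ (a i) x)) ∧
    (∀ x, p x = curvatureWeights a g x) ∧
    (∀ x, law x = withReplacement m (curvatureWeights a g x)) ∧
    1 / (n : ℝ) * ∑ i, K i ≤ KH ∧
    4 * (1 / (n : ℝ) * ∑ i, K i) ^ 2 / ε ^ 2 * Real.log (2 * d / δ₀) ≤ m

/-- The random samples `S t` and iterates `x t`: `ℱ t` is the information available before the
sample of iteration `t` is drawn, and, as long as the algorithm has not returned, the conditional
distribution of `S t` given `ℱ t` is `law (x t)`. (The trial steps may use further randomness.) -/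
structure IsSampled {Ω : Type*} {mΩ : MeasurableSpace Ω} (μ : Measure Ω) (ℱ : Filtration ℕ mΩ)
    {d n m : ℕ} (f : Fin n → Vec d → ℝ) (εg εH : ℝ)
    (p : Vec d → Fin n → ℝ) (law : Vec d → (Fin m → Fin n) → ℝ)
    (S : ℕ → Ω → Fin m → Fin n) (x : ℕ → Ω → Vec d) : Prop where
  x_meas : ∀ t, Measurable[ℱ t] (x t)
  S_meas : ∀ t, Measurable[ℱ (t + 1)] (S t)
  cond_law : ∀ (t : ℕ) (J : Fin m → Fin n), ∀ᵐ ω ∂μ,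
    (∀ k < t, ¬ Stops (finiteSum f) εg εH (x k ω)
      (subsampledHess f (p (x k ω)) (S k ω) (x k ω))) →
    (μ[({ω' | S t ω' = J} : Set Ω).indicator (fun _ => (1 : ℝ)) | ℱ t]) ω = law (x t ω) J

/-- The event that the algorithm returns at an iteration `t` with at most `T` iterations
`0, …, t` performed, and that the returned point `x t` satisfies `‖∇F‖ ≤ ε_g` and
`λ_min(∇²F) ≥ -(ε + ε_H)`. -/
def goodEvent {Ω : Type*} {d n m : ℕ} (f : Fin n → Vec d → ℝ) (εg εH ε T : ℝ)
    (p : Vec d → Fin n → ℝ) (S : ℕ → Ω → Fin m → Fin n) (x : ℕ → Ω → Vec d) : Set Ω :=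
  {ω | ∃ t : ℕ, (t : ℝ) + 1 ≤ T ∧
    Stops (finiteSum f) εg εH (x t ω) (subsampledHess f (p (x t ω)) (S t ω) (x t ω)) ∧
    (∀ k < t, ¬ Stops (finiteSum f) εg εH (x k ω)
      (subsampledHess f (p (x k ω)) (S k ω) (x k ω))) ∧
    ‖gradient (finiteSum f) (x t ω)‖ ≤ εg ∧
    -(ε + εH) ≤ lambdaMin (hess (finiteSum f) (x t ω))}

end SubsampledARC

end

/-! A deterministic iteration count, valid while every sampled Hessian is within `ε` of the true
one, is combined by a union bound with a matrix concentration inequality for a single sample.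

Concentration (`sum_exp_eigenvalues_le`, `tail_opNorm_le`) uses exchangeable pairs. Let `S` be the
centred sum over a random list of indices. Replacing one entry of the list is a reversible move,
with rates chosen so that the total displacement of `S` over all moves is `S` itself. The derivative
in `θ` of the mean of `tr exp(θS)` is then a sum over moves `S → S'` of `tr((S - S') exp(θS))`.
Reversibility symmetrizes it to half of `tr((S - S')(exp(θS) - exp(θS')))`, which
`mean_value_trace_exp` bounds by a multiple of `θ R² tr exp`. Gronwall's argument gives a
sub-Gaussian bound. Sampling with and without replacement differ only in the rates. For non-uniform
sampling, the curvature of a ridge function is its Hessian norm (`abs_deriv_deriv_mul_norm_sq`), so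
the weights give all nonzero rescaled Hessians the same norm.

Iteration count (`exists_iteration_bound`). If `σ ≥ 2L`, the actual decrease falls short of the
model decrease by at most `2ε³/σ²`, whatever the step length (`decrease_ge_model`). The tolerance
makes this at most `1 - η` times the guaranteed model decrease (`tolerance_cubed_le`), so the step
is accepted. Hence rejections occur only below `2L` and `σ` stays bounded. Each accepted step then
lowers `F` by a multiple of `min(εg², εH³)`, and rejections are paid for by the growth of `log σ`.

Probability. The tail bound is uniform in the point, so it survives conditioning on the past
(`measureReal_bad_le`). Summing over the allowed iterations, almost surely outside the exceptional
event the run stops in time, and Weyl's inequality moves the eigenvalue test from the sampled to the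
true Hessian. -/

namespace SubsampledARC

/-! ### Trace inequalities for the exponential -/

/-- The trapezoidal rule overestimates the integral of the exponential. -/
theorem exp_sub_one_le_trapezoid {u : ℝ} (hu : 0 ≤ u) :
    Real.exp u - 1 ≤ u / 2 * (Real.exp u + 1) := by
  have hd : ∀ v : ℝ, HasDerivAt (fun v => v / 2 * (Real.exp v + 1) - Real.exp v)
      (1 / 2 * (Real.exp v + 1) + v / 2 * Real.exp v - Real.exp v) v := fun v =>
    (((hasDerivAt_id v).div_const 2).mul ((Real.hasDerivAt_exp v).add_const 1)).sub
      (Real.hasDerivAt_exp v)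
  have hmono : MonotoneOn (fun v => v / 2 * (Real.exp v + 1) - Real.exp v) (Set.Ici 0) := by
    refine monotoneOn_of_deriv_nonneg (convex_Ici 0)
      (fun v _ => (hd v).continuousAt.continuousWithinAt)
      (fun v _ => (hd v).differentiableAt.differentiableWithinAt) fun v _ => ?_
    rw [(hd v).deriv]
    have h1 : 1 - v ≤ Real.exp (-v) := by linarith [Real.add_one_le_exp (-v)]
    have h2 : (1 - v) * Real.exp v ≤ 1 := by
      have := mul_le_mul_of_nonneg_right h1 (Real.exp_pos v).le
      rwa [← Real.exp_add, neg_add_cancel, Real.exp_zero] at this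
    linarith
  have := hmono (Set.mem_Ici.2 le_rfl) (Set.mem_Ici.2 hu) hu
  simp only [zero_div, zero_mul, Real.exp_zero] at this
  linarith

/-- The mean value trace inequality for numbers. It is symmetric in `a` and `b`, and for `b ≤ a` it
is the trapezoidal bound at `u = a - b` multiplied by `u * exp b`. -/
theorem sub_mul_exp_sub_exp_le (a b : ℝ) :
    (a - b) * (Real.exp a - Real.exp b) ≤
      1 / 2 * ((a - b) ^ 2 * (Real.exp a + Real.exp b)) := by
  wlog h : b ≤ a generalizing a b
  · have := this b a (le_of_not_ge h)
    nlinarith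
  have hu : 0 ≤ a - b := sub_nonneg.2 h
  have h1 := mul_le_mul_of_nonneg_left (exp_sub_one_le_trapezoid hu)
    (mul_nonneg hu (Real.exp_pos b).le)
  have h2 : Real.exp b * Real.exp (a - b) = Real.exp a := by
    rw [← Real.exp_add]; congr 1; ring
  have e1 : (a - b) * Real.exp b * (Real.exp (a - b) - 1) =
      (a - b) * (Real.exp a - Real.exp b) := by rw [← h2]; ring
  have e2 : (a - b) * Real.exp b * ((a - b) / 2 * (Real.exp (a - b) + 1)) =
      1 / 2 * ((a - b) ^ 2 * (Real.exp a + Real.exp b)) := by rw [← h2]; ring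
  rwa [e1, e2] at h1

section Trace

variable {E ι : Type*} [NormedAddCommGroup E] [InnerProductSpace ℝ E] [Fintype ι]

theorem isSymmetric_of_eigenbasis (u : OrthonormalBasis ι ℝ E) (a : ι → ℝ) (A : E →L[ℝ] E)
    (hA : ∀ i, A (u i) = a i • u i) (x y : E) : inner ℝ (A x) y = inner ℝ x (A y) := by
  rw [← u.sum_repr x, ← u.sum_repr y]
  simp only [map_sum, map_smul, hA, sum_inner, inner_sum, inner_smul_left, inner_smul_right,
    Finset.mul_sum]
  refine Finset.sum_congr rfl fun i _ => Finset.sum_congr rfl fun j _ => ?_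
  classical
  rcases eq_or_ne j i with rfl | hij
  · simp only [conj_trivial]; ring
  · simp [u.inner_eq_ite, hij]

theorem inner_sub_eigenbasis (u v : OrthonormalBasis ι ℝ E) (a b : ι → ℝ) (A B : E →L[ℝ] E)
    (hA : ∀ i, A (u i) = a i • u i) (hB : ∀ i, B (v i) = b i • v i) (i j : ι) :
    inner ℝ (v j) ((A - B) (u i)) = (a i - b j) * inner ℝ (v j) (u i) := by
  rw [sub_apply, inner_sub_right, ← isSymmetric_of_eigenbasis v b B hB, hA, hB,
    inner_smul_left, inner_smul_right]
  simp
  ring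

/-- The mean value trace inequality
`tr ((A - B) (exp A - exp B)) ≤ tr ((A - B)² (exp A + exp B)) / 2`, in eigenbases. -/
theorem mean_value_trace_exp (u v : OrthonormalBasis ι ℝ E) (a b : ι → ℝ) (A B : E →L[ℝ] E)
    (hA : ∀ i, A (u i) = a i • u i) (hB : ∀ i, B (v i) = b i • v i) :
    ∑ i, Real.exp (a i) * inner ℝ (u i) ((A - B) (u i)) +
      ∑ i, Real.exp (b i) * inner ℝ (v i) ((B - A) (v i)) ≤
    1 / 2 * (∑ i, Real.exp (a i) * ‖(A - B) (u i)‖ ^ 2 +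
      ∑ i, Real.exp (b i) * ‖(B - A) (v i)‖ ^ 2) := by
  -- Between the two eigenbases `A - B` has entries `(a i - b j) ⟨v j, u i⟩`. All four traces thus
  -- become double sums with the common weights `⟨v j, u i⟩²`, and the claim reduces to the scalar
  -- inequality term by term.
  have key : ∀ (u v : OrthonormalBasis ι ℝ E) (a b : ι → ℝ) (A B : E →L[ℝ] E)
      (_ : ∀ i, A (u i) = a i • u i) (_ : ∀ i, B (v i) = b i • v i) (i : ι),
      inner ℝ (u i) ((A - B) (u i)) = ∑ j, (a i - b j) * inner ℝ (u i) (v j) ^ 2 ∧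
      ‖(A - B) (u i)‖ ^ 2 = ∑ j, (a i - b j) ^ 2 * inner ℝ (u i) (v j) ^ 2 := by
    intro u v a b A B hA hB i
    constructor
    · rw [← v.sum_inner_mul_inner]
      refine Finset.sum_congr rfl fun j _ => ?_
      rw [inner_sub_eigenbasis u v a b A B hA hB, real_inner_comm (v j) (u i)]
      ring
    · rw [← v.sum_sq_norm_inner_right]
      refine Finset.sum_congr rfl fun j _ => ?_
      rw [inner_sub_eigenbasis u v a b A B hA hB, Real.norm_eq_abs, sq_abs,
        real_inner_comm (v j) (u i)]
      ring
  have e1 : ∑ i, Real.exp (a i) * inner ℝ (u i) ((A - B) (u i)) =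
      ∑ i, ∑ j, Real.exp (a i) * ((a i - b j) * inner ℝ (u i) (v j) ^ 2) := by
    refine Finset.sum_congr rfl fun i _ => ?_
    rw [(key u v a b A B hA hB i).1, Finset.mul_sum]
  have e2 : ∑ i, Real.exp (a i) * ‖(A - B) (u i)‖ ^ 2 =
      ∑ i, ∑ j, Real.exp (a i) * ((a i - b j) ^ 2 * inner ℝ (u i) (v j) ^ 2) := by
    refine Finset.sum_congr rfl fun i _ => ?_
    rw [(key u v a b A B hA hB i).2, Finset.mul_sum]
  have e3 : ∑ i, Real.exp (b i) * inner ℝ (v i) ((B - A) (v i)) =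
      ∑ i, ∑ j, Real.exp (b j) * ((b j - a i) * inner ℝ (v j) (u i) ^ 2) := by
    rw [Finset.sum_comm]
    refine Finset.sum_congr rfl fun i _ => ?_
    rw [(key v u b a B A hB hA i).1, Finset.mul_sum]
  have e4 : ∑ i, Real.exp (b i) * ‖(B - A) (v i)‖ ^ 2 =
      ∑ i, ∑ j, Real.exp (b j) * ((b j - a i) ^ 2 * inner ℝ (v j) (u i) ^ 2) := by
    rw [Finset.sum_comm]
    refine Finset.sum_congr rfl fun i _ => ?_
    rw [(key v u b a B A hB hA i).2, Finset.mul_sum]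
  rw [e1, e2, e3, e4, ← Finset.sum_add_distrib, ← Finset.sum_add_distrib, Finset.mul_sum]
  refine Finset.sum_le_sum fun i _ => ?_
  rw [← Finset.sum_add_distrib, ← Finset.sum_add_distrib, Finset.mul_sum]
  refine Finset.sum_le_sum fun j _ => ?_
  rw [real_inner_comm (v j) (u i)]
  have := mul_le_mul_of_nonneg_right (sub_mul_exp_sub_exp_le (a i) (b j))
    (sq_nonneg (inner ℝ (v j) (u i)))
  linarith

end Trace

/-! ### Concentration by exchangeable pairs -/

section Exchange

variable {E ι X κ : Type*} [NormedAddCommGroup E] [InnerProductSpace ℝ E] [Fintype ι]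
  [Fintype X] [Fintype κ]

/-- Matrix exponential moment bound by the method of exchangeable pairs: `w` is the weight of the
state `J`, and `r J e` is the rate of the move `J ↦ T J e`. -/
theorem sum_exp_eigenvalues_le (w : X → ℝ) (r : X → κ → ℝ) (T : X → κ → X)
    (S : X → E →L[ℝ] E) (U : X → OrthonormalBasis ι ℝ E) (l : X → ι → ℝ) (M R : ℝ)
    (hS : ∀ J i, S J (U J i) = l J i • U J i)
    (hr : ∀ J e, 0 ≤ r J e)
    (hsymm : ∀ Φ : X → X → ℝ,
      ∑ J, ∑ e, r J e * Φ J (T J e) = ∑ J, ∑ e, r J e * Φ (T J e) J)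
    (hdrift : ∀ J, ∑ e, r J e • (S J - S (T J e)) = w J • S J)
    (hmass : ∀ J, ∑ e, r J e ≤ M * w J)
    (hR : ∀ J e, ‖S J - S (T J e)‖ ≤ R) {θ : ℝ} (hθ : 0 ≤ θ) :
    ∑ J, w J * ∑ i, Real.exp (θ * l J i) ≤
      Fintype.card ι * (∑ J, w J) * Real.exp (M * R ^ 2 * θ ^ 2 / 4) := by
  set f : ℝ → ℝ := fun θ => ∑ J, w J * ∑ i, Real.exp (θ * l J i) with hf
  have hfd : ∀ θ, HasDerivAt f (∑ J, w J * ∑ i, Real.exp (θ * l J i) * l J i) θ := by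
    intro θ
    refine HasDerivAt.fun_sum fun J _ => HasDerivAt.const_mul _ <| HasDerivAt.fun_sum fun i _ => ?_
    simpa using ((hasDerivAt_id θ).mul_const (l J i)).exp
  -- The differential inequality `f' ≤ (M R² / 2) θ f`.
  have hf' : ∀ θ, 0 < θ → ∑ J, w J * ∑ i, Real.exp (θ * l J i) * l J i ≤
      M * R ^ 2 / 2 * θ * f θ := by
    intro θ hθ
    set Z : X → ℝ := fun J => ∑ i, Real.exp (θ * l J i) with hZ
    set G : X → X → ℝ := fun J J' =>
      ∑ i, Real.exp (θ * l J i) * inner ℝ (U J i) ((S J - S J') (U J i)) with hG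
    have hZ0 : ∀ J, 0 ≤ Z J := fun J => Finset.sum_nonneg fun i _ => (Real.exp_pos _).le
    have h1 : ∑ J, w J * ∑ i, Real.exp (θ * l J i) * l J i =
        ∑ J, ∑ e, r J e * G J (T J e) := by
      refine Finset.sum_congr rfl fun J _ => ?_
      have : ∀ i, w J * l J i =
          ∑ e, r J e * inner ℝ (U J i) ((S J - S (T J e)) (U J i)) := by
        intro i
        have h := congrArg (fun A : E →L[ℝ] E => inner ℝ (U J i) (A (U J i))) (hdrift J)
        simp only [sum_apply, smul_apply, inner_sum,
          inner_smul_right, hS] at h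
        simp only [real_inner_self_eq_norm_sq, (U J).norm_eq_one, one_pow, mul_one] at h
        exact h.symm
      simp only [hG, Finset.mul_sum]
      rw [Finset.sum_comm]
      refine Finset.sum_congr rfl fun i _ => ?_
      rw [show w J * (Real.exp (θ * l J i) * l J i) = Real.exp (θ * l J i) * (w J * l J i) by ring,
        this, Finset.mul_sum]
      exact Finset.sum_congr rfl fun e _ => by ring
    have h2 : ∀ J e, G J (T J e) + G (T J e) J ≤
        1 / 2 * θ * R ^ 2 * (Z J + Z (T J e)) := by
      intro J e
      have h := mean_value_trace_exp (U J) (U (T J e)) (fun i => θ * l J i)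
        (fun i => θ * l (T J e) i) (θ • S J) (θ • S (T J e))
        (fun i => by simp [hS, smul_smul]) (fun i => by simp [hS, smul_smul])
      have hb : ∀ (u : OrthonormalBasis ι ℝ E) (a : ι → ℝ) (D : E →L[ℝ] E), ‖D‖ ≤ R →
          ∑ i, Real.exp (a i) * ‖D (u i)‖ ^ 2 ≤ R ^ 2 * ∑ i, Real.exp (a i) := by
        intro u a D hD
        rw [Finset.mul_sum]
        refine Finset.sum_le_sum fun i _ => ?_
        rw [mul_comm]
        refine mul_le_mul_of_nonneg_right ?_ (Real.exp_pos _).le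
        refine pow_le_pow_left₀ (norm_nonneg _) ?_ 2
        exact (D.le_opNorm _).trans (by simpa using hD)
      have hR' : ‖S (T J e) - S J‖ ≤ R := by rw [norm_sub_rev]; exact hR J e
      have b1 := hb (U J) (fun i => θ * l J i) _ (hR J e)
      have b2 := hb (U (T J e)) (fun i => θ * l (T J e) i) _ hR'
      simp only [← smul_sub, smul_apply, inner_smul_right, norm_smul,
        mul_pow, Real.norm_eq_abs, sq_abs] at h
      have c1 : ∀ (u : OrthonormalBasis ι ℝ E) (a : ι → ℝ) (D : E →L[ℝ] E),
          ∑ i, Real.exp (a i) * (θ * inner ℝ (u i) (D (u i))) =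
          θ * ∑ i, Real.exp (a i) * inner ℝ (u i) (D (u i)) := by
        intro u a D; rw [Finset.mul_sum]; exact Finset.sum_congr rfl fun i _ => by ring
      have c2 : ∀ (u : OrthonormalBasis ι ℝ E) (a : ι → ℝ) (D : E →L[ℝ] E),
          ∑ i, Real.exp (a i) * (θ ^ 2 * ‖D (u i)‖ ^ 2) =
          θ ^ 2 * ∑ i, Real.exp (a i) * ‖D (u i)‖ ^ 2 := by
        intro u a D; rw [Finset.mul_sum]; exact Finset.sum_congr rfl fun i _ => by ring
      rw [c1 (U J), c1 (U (T J e)), c2 (U J), c2 (U (T J e))] at h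
      have h3 : θ * (G J (T J e) + G (T J e) J) ≤
          θ * (1 / 2 * θ * R ^ 2 * (Z J + Z (T J e))) := by
        have b3 := mul_le_mul_of_nonneg_left (add_le_add b1 b2) (by positivity : 0 ≤ 1 / 2 * θ ^ 2)
        simp only [hG, hZ]
        linarith
      exact le_of_mul_le_mul_left h3 hθ
    -- Write the sum twice and reverse the moves in one copy. This pairs `G J J'` with `G J' J`,
    -- which is what `h2` controls; the same reversal merges the two `Z` terms.
    have h3 : 2 * ∑ J, ∑ e, r J e * G J (T J e) ≤
        1 / 2 * θ * R ^ 2 * (2 * ∑ J, ∑ e, r J e * Z J) := by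
      rw [two_mul]
      nth_rewrite 2 [hsymm G]
      have hz := hsymm (fun J _ => Z J)
      rw [two_mul (∑ J, ∑ e, r J e * Z J)]
      nth_rewrite 2 [hz]
      simp only [← Finset.sum_add_distrib, Finset.mul_sum]
      refine Finset.sum_le_sum fun J _ => Finset.sum_le_sum fun e _ => ?_
      have := mul_le_mul_of_nonneg_left (h2 J e) (hr J e)
      linarith
    have h4 : ∑ J, ∑ e, r J e * Z J ≤ M * f θ := by
      rw [hf, Finset.mul_sum]
      refine Finset.sum_le_sum fun J _ => ?_
      rw [← Finset.sum_mul, ← mul_assoc]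
      exact mul_le_mul_of_nonneg_right (hmass J) (hZ0 J)
    rw [h1]
    have h5 := mul_le_mul_of_nonneg_left h4 (by positivity : 0 ≤ 1 / 2 * θ * R ^ 2)
    linarith
  -- Integrating factor: by `hf'` this product is antitone on `[0, ∞)`, and its value at `0` is the
  -- dimension times the total weight.
  have hgd : ∀ θ, HasDerivAt (fun θ => f θ * Real.exp (-(M * R ^ 2 * θ ^ 2 / 4)))
      ((∑ J, w J * ∑ i, Real.exp (θ * l J i) * l J i) * Real.exp (-(M * R ^ 2 * θ ^ 2 / 4)) +
        f θ * (Real.exp (-(M * R ^ 2 * θ ^ 2 / 4)) * -(M * R ^ 2 / 2 * θ))) θ := by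
    intro θ
    refine (hfd θ).mul (HasDerivAt.exp ?_)
    have := (((hasDerivAt_pow 2 θ).const_mul (M * R ^ 2)).div_const 4).neg
    refine this.congr_deriv ?_
    simp
    ring
  have hanti : AntitoneOn (fun θ => f θ * Real.exp (-(M * R ^ 2 * θ ^ 2 / 4))) (Set.Ici 0) := by
    refine antitoneOn_of_deriv_nonpos (convex_Ici 0)
      (fun v _ => (hgd v).continuousAt.continuousWithinAt)
      (fun v _ => (hgd v).differentiableAt.differentiableWithinAt) fun v hv => ?_
    rw [interior_Ici] at hv
    rw [(hgd v).deriv]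
    have := mul_le_mul_of_nonneg_right (hf' v hv) (Real.exp_pos (-(M * R ^ 2 * v ^ 2 / 4))).le
    linarith
  have h := hanti (Set.mem_Ici.2 le_rfl) (Set.mem_Ici.2 hθ) hθ
  have h0 : f 0 = Fintype.card ι * ∑ J, w J := by
    simp [hf, Finset.sum_mul, mul_comm]
  simp only [h0] at h
  rw [Real.exp_neg, ← div_eq_mul_inv, div_le_iff₀ (Real.exp_pos _)] at h
  simpa using h

open Classical in
/-- Tail bound for the largest eigenvalue, by the method of exchangeable pairs. -/
theorem tail_eigenvalues_le (w : X → ℝ) (r : X → κ → ℝ) (T : X → κ → X)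
    (S : X → E →L[ℝ] E) (U : X → OrthonormalBasis ι ℝ E) (l : X → ι → ℝ) (M R t : ℝ)
    (hS : ∀ J i, S J (U J i) = l J i • U J i) (hw : ∀ J, 0 ≤ w J) (hw1 : ∑ J, w J = 1)
    (hr : ∀ J e, 0 ≤ r J e)
    (hsymm : ∀ Φ : X → X → ℝ,
      ∑ J, ∑ e, r J e * Φ J (T J e) = ∑ J, ∑ e, r J e * Φ (T J e) J)
    (hdrift : ∀ J, ∑ e, r J e • (S J - S (T J e)) = w J • S J)
    (hmass : ∀ J, ∑ e, r J e ≤ M * w J)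
    (hR : ∀ J e, ‖S J - S (T J e)‖ ≤ R) (ht : 0 ≤ t) (hM : 0 < M) (hR0 : 0 < R) :
    ∑ J, (if ∃ i, t < l J i then w J else 0) ≤
      Fintype.card ι * Real.exp (-(t ^ 2 / (M * R ^ 2))) := by
  -- The minimizer of the exponent `M R² θ² / 4 - θ t`.
  set θ := 2 * t / (M * R ^ 2) with hθ
  have hθ0 : 0 ≤ θ := by positivity
  have h := sum_exp_eigenvalues_le w r T S U l M R hS hr hsymm hdrift hmass hR hθ0
  rw [hw1, mul_one] at h
  have h1 : ∑ J, (if ∃ i, t < l J i then w J else 0) ≤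
      Real.exp (-(θ * t)) * ∑ J, w J * ∑ i, Real.exp (θ * l J i) := by
    rw [Finset.mul_sum]
    refine Finset.sum_le_sum fun J _ => ?_
    have hsum : 0 ≤ ∑ i, Real.exp (θ * l J i) :=
      Finset.sum_nonneg fun i _ => (Real.exp_pos _).le
    split_ifs with hJ
    · obtain ⟨i, hi⟩ := hJ
      have h2 : Real.exp (θ * t) ≤ ∑ i, Real.exp (θ * l J i) :=
        (Real.exp_le_exp.2 (mul_le_mul_of_nonneg_left hi.le hθ0)).trans
          (Finset.single_le_sum (f := fun i => Real.exp (θ * l J i))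
            (fun i _ => (Real.exp_pos _).le) (Finset.mem_univ i))
      have h3 := mul_le_mul_of_nonneg_left h2 (Real.exp_pos (-(θ * t))).le
      rw [← Real.exp_add, neg_add_cancel, Real.exp_zero] at h3
      have := mul_le_mul_of_nonneg_left h3 (hw J)
      linarith
    · exact mul_nonneg (Real.exp_pos _).le (mul_nonneg (hw J) hsum)
  refine h1.trans ((mul_le_mul_of_nonneg_left h (Real.exp_pos _).le).trans_eq ?_)
  rw [mul_left_comm, ← Real.exp_add]
  congr 2
  rw [hθ]
  field_simp
  ring

/-- Parseval in the eigenbasis, where each coordinate is multiplied by an eigenvalue. -/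
theorem opNorm_le_of_eigenbasis (u : OrthonormalBasis ι ℝ E) (a : ι → ℝ) (A : E →L[ℝ] E)
    (hA : ∀ i, A (u i) = a i • u i) {t : ℝ} (ht : 0 ≤ t) (ha : ∀ i, |a i| ≤ t) : ‖A‖ ≤ t := by
  refine A.opNorm_le_bound ht fun x => ?_
  refine le_of_sq_le_sq ?_ (by positivity)
  rw [mul_pow, ← u.sum_sq_norm_inner_right (A x), ← u.sum_sq_norm_inner_right x, Finset.mul_sum]
  refine Finset.sum_le_sum fun i _ => ?_
  rw [← isSymmetric_of_eigenbasis u a A hA, hA, inner_smul_left, norm_mul, mul_pow]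
  refine mul_le_mul_of_nonneg_right ?_ (sq_nonneg _)
  exact pow_le_pow_left₀ (norm_nonneg _) (by simpa using ha i) 2

open Classical in
/-- Concentration of the operator norm, by the method of exchangeable pairs. -/
theorem tail_opNorm_le [FiniteDimensional ℝ E] (w : X → ℝ) (r : X → κ → ℝ) (T : X → κ → X)
    (S : X → E →L[ℝ] E) (M R t : ℝ)
    (hS : ∀ J, ((S J : E →L[ℝ] E) : E →ₗ[ℝ] E).IsSymmetric) (hw : ∀ J, 0 ≤ w J)
    (hw1 : ∑ J, w J = 1) (hr : ∀ J e, 0 ≤ r J e)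
    (hsymm : ∀ Φ : X → X → ℝ,
      ∑ J, ∑ e, r J e * Φ J (T J e) = ∑ J, ∑ e, r J e * Φ (T J e) J)
    (hdrift : ∀ J, ∑ e, r J e • (S J - S (T J e)) = w J • S J)
    (hmass : ∀ J, ∑ e, r J e ≤ M * w J)
    (hR : ∀ J e, ‖S J - S (T J e)‖ ≤ R) (ht : 0 ≤ t) (hM : 0 < M) (hR0 : 0 < R) :
    ∑ J, (if t < ‖S J‖ then w J else 0) ≤
      2 * Module.finrank ℝ E * Real.exp (-(t ^ 2 / (M * R ^ 2))) := by
  set U : X → OrthonormalBasis (Fin (Module.finrank ℝ E)) ℝ E :=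
    fun J => (hS J).eigenvectorBasis rfl with hU
  set l : X → Fin (Module.finrank ℝ E) → ℝ := fun J => (hS J).eigenvalues rfl with hl
  have hSU : ∀ J i, S J (U J i) = l J i • U J i := fun J i =>
    (hS J).apply_eigenvectorBasis rfl i
  have h1 := tail_eigenvalues_le w r T S U l M R t hSU hw hw1 hr hsymm hdrift hmass hR ht hM hR0
  -- The lower tail: the same moves serve `-S`. The two tails together account for the factor `2`.
  have h2 := tail_eigenvalues_le w r T (fun J => -S J) U (fun J i => -l J i) M R t
    (fun J i => by simp [hSU]) hw hw1 hr hsymm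
    (fun J => by
      rw [smul_neg, ← hdrift J, ← Finset.sum_neg_distrib]
      refine Finset.sum_congr rfl fun e _ => ?_
      rw [← smul_neg]; congr 1; abel)
    hmass
    (fun J e => by rw [neg_sub_neg, norm_sub_rev]; exact hR J e) ht hM hR0
  have h3 : ∑ J, (if t < ‖S J‖ then w J else 0) ≤
      ∑ J, (if ∃ i, t < l J i then w J else 0) + ∑ J, (if ∃ i, t < -l J i then w J else 0) := by
    rw [← Finset.sum_add_distrib]
    refine Finset.sum_le_sum fun J _ => ?_
    by_cases hJ : t < ‖S J‖
    · have : (∃ i, t < l J i) ∨ ∃ i, t < -l J i := by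
        by_contra! hc
        refine absurd (opNorm_le_of_eigenbasis (U J) (l J) (S J) (hSU J) ht fun i => ?_)
          (not_le.2 hJ)
        exact abs_le.2 ⟨by linarith [hc.2 i], hc.1 i⟩
      rw [if_pos hJ]
      have h0 := hw J
      rcases this with h | h <;> rw [if_pos h] <;> split_ifs <;> linarith
    · rw [if_neg hJ]
      have h0 := hw J
      split_ifs <;> linarith
  rw [Fintype.card_fin] at h1 h2
  have h4 := h3.trans (add_le_add (le_of_eq_of_le (by congr!) h1) (le_of_eq_of_le (by congr!) h2))
  linarith

end Exchange

/-! ### Reversible moves on samples -/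

section Moves

variable {m n : ℕ}

/-- Symmetry of the moves that replace one entry of a list. -/
theorem sum_update_symm (r : (Fin m → Fin n) → Fin m × Fin n → ℝ)
    (hr : ∀ J k i, r (Function.update J k i) (k, J k) = r J (k, i))
    (Φ : (Fin m → Fin n) → (Fin m → Fin n) → ℝ) :
    ∑ J, ∑ e : Fin m × Fin n, r J e * Φ J (Function.update J e.1 e.2) =
      ∑ J, ∑ e : Fin m × Fin n, r J e * Φ (Function.update J e.1 e.2) J := by
  let τ : (Fin m → Fin n) × Fin m × Fin n → (Fin m → Fin n) × Fin m × Fin n :=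
    fun q => (Function.update q.1 q.2.1 q.2.2, q.2.1, q.1 q.2.1)
  have hτ : Function.Involutive τ := by
    rintro ⟨J, k, i⟩
    simp [τ]
  rw [← Fintype.sum_prod_type', ← Fintype.sum_prod_type', ← hτ.toPerm.sum_comp _ _ (by simp)]
  refine Finset.sum_congr rfl ?_
  rintro ⟨J, k, i⟩ -
  simp [τ, hr]

theorem sum_sub_sum_update {G : Type*} [AddCommGroup G] (A : Fin n → G) (J : Fin m → Fin n)
    (k : Fin m) (i : Fin n) :
    ∑ l, A (J l) - ∑ l, A (Function.update J k i l) = A (J k) - A i := by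
  rw [← Finset.sum_sub_distrib, Finset.sum_eq_single k]
  · simp
  · intro l _ hl
    simp [Function.update_of_ne hl]
  · simp

theorem withReplacement_nonneg (p : Fin n → ℝ) (hp : ∀ i, 0 ≤ p i) (J : Fin m → Fin n) :
    0 ≤ withReplacement m p J :=
  Finset.prod_nonneg fun k _ => hp (J k)

theorem sum_withReplacement (p : Fin n → ℝ) (hp : ∑ i, p i = 1) :
    ∑ J, withReplacement m p J = 1 := by
  have h := Finset.prod_univ_sum (fun _ : Fin m => (Finset.univ : Finset (Fin n)))
    (fun _ i => p i)
  rw [Fintype.piFinset_univ] at h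
  simp only [withReplacement]
  rw [← h]
  simp [hp]

/-- Detailed balance for redrawing one entry from `p`. -/
theorem withReplacement_update (p : Fin n → ℝ) (J : Fin m → Fin n) (k : Fin m) (i : Fin n) :
    withReplacement m p (Function.update J k i) * p (J k) = withReplacement m p J * p i := by
  unfold withReplacement
  rw [← Finset.mul_prod_erase _ _ (Finset.mem_univ k),
    ← Finset.mul_prod_erase _ (fun l => p (J l)) (Finset.mem_univ k)]
  have : ∏ l ∈ Finset.univ.erase k, p (Function.update J k i l) =
      ∏ l ∈ Finset.univ.erase k, p (J l) :=
    Finset.prod_congr rfl fun l hl => by rw [Function.update_of_ne (Finset.ne_of_mem_erase hl)]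
  rw [this, Function.update_self]
  ring

theorem withoutReplacement_nonneg (J : Fin m → Fin n) : 0 ≤ withoutReplacement n m J := by
  unfold withoutReplacement
  split_ifs <;> positivity

theorem sum_withoutReplacement (hmn : m ≤ n) : ∑ J, withoutReplacement n m J = 1 := by
  classical
  unfold withoutReplacement
  rw [← Finset.sum_filter, Finset.sum_const, nsmul_eq_mul, ← Fintype.card_subtype,
    Fintype.card_congr (Equiv.subtypeInjectiveEquivEmbedding (Fin m) (Fin n)),
    Fintype.card_embedding_eq, Fintype.card_fin, Fintype.card_fin]
  have : (n.descFactorial m : ℝ) ≠ 0 := by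
    exact_mod_cast (Nat.descFactorial_pos.2 hmn).ne'
  field_simp

/-- Exchanging a drawn index for one that was not drawn is reversible. -/
theorem injective_update_of_notMem_range {J : Fin m → Fin n} {k : Fin m} {i : Fin n}
    (h : Function.Injective J ∧ i ∉ Set.range J) :
    Function.Injective (Function.update J k i) ∧ J k ∉ Set.range (Function.update J k i) := by
  obtain ⟨hJ, hi⟩ := h
  have hne : ∀ l, J l ≠ i := fun l hl => hi ⟨l, hl⟩
  constructor
  · intro a b hab
    by_cases ha : a = k <;> by_cases hb : b = k
    · rw [ha, hb]
    · subst ha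
      rw [Function.update_self, Function.update_of_ne hb] at hab
      exact absurd hab.symm (hne b)
    · subst hb
      rw [Function.update_self, Function.update_of_ne ha] at hab
      exact absurd hab (hne a)
    · rw [Function.update_of_ne ha, Function.update_of_ne hb] at hab
      exact hJ hab
  · rintro ⟨l, hl⟩
    by_cases hlk : l = k
    · subst hlk
      rw [Function.update_self] at hl
      exact hne l hl.symm
    · rw [Function.update_of_ne hlk] at hl
      exact hlk (hJ hl)

open Classical in
theorem sum_notMem_range {G : Type*} [AddCommGroup G] {J : Fin m → Fin n}
    (hJ : Function.Injective J) (c : Fin n → G) :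
    ∑ i, (if i ∉ Set.range J then c i else 0) = ∑ i, c i - ∑ k, c (J k) := by
  have h : ∑ k, c (J k) = ∑ i, (if i ∈ Set.range J then c i else 0) := by
    rw [← Finset.sum_filter, ← Finset.sum_image (f := c) (fun a _ b _ h => hJ h)]
    refine Finset.sum_congr ?_ fun _ _ => rfl
    ext i
    simp
  rw [h, ← Finset.sum_sub_distrib]
  refine Finset.sum_congr rfl fun i _ => ?_
  by_cases hi : i ∈ Set.range J <;> simp [hi]

end Moves

/-! ### Tail bounds for sample means -/

section Tail

variable {E : Type*} [NormedAddCommGroup E] [InnerProductSpace ℝ E] [FiniteDimensional ℝ E]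
  {m n : ℕ}

open Classical in
/-- Concentration of the mean of a sample, given reversible moves of the sample. -/
theorem tail_mean_le (hm : 0 < m) (w : (Fin m → Fin n) → ℝ)
    (r : (Fin m → Fin n) → Fin m × Fin n → ℝ) (A : Fin n → E →L[ℝ] E) (B : E →L[ℝ] E)
    (hA : ∀ i, ((A i : E →L[ℝ] E) : E →ₗ[ℝ] E).IsSymmetric)
    (hB : (B : E →ₗ[ℝ] E).IsSymmetric)
    (hw : ∀ J, 0 ≤ w J) (hw1 : ∑ J, w J = 1) (hr : ∀ J e, 0 ≤ r J e)
    (hsymm : ∀ J k i, r (Function.update J k i) (k, J k) = r J (k, i))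
    (hdrift : ∀ J, ∑ e : Fin m × Fin n, r J e • (A (J e.1) - A e.2) =
      w J • (∑ k, A (J k) - (m : ℝ) • B))
    (hmass : ∀ J, ∑ e, r J e ≤ m * w J)
    {κ ε δ : ℝ} (hκ : 0 < κ) (hAκ : ∀ i, ‖A i‖ ≤ κ) (hε : 0 < ε) (hδ : 0 < δ)
    (hE : 0 < Module.finrank ℝ E)
    (hsize : 4 * κ ^ 2 / ε ^ 2 * Real.log (2 * Module.finrank ℝ E / δ) ≤ m) :
    ∑ J, (if ε < ‖(1 / (m : ℝ)) • ∑ k, A (J k) - B‖ then w J else 0) ≤ δ := by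
  have hm' : (0 : ℝ) < m := Nat.cast_pos.2 hm
  have hE' : (0 : ℝ) < Module.finrank ℝ E := Nat.cast_pos.2 hE
  -- One move changes the sum by at most `R = 2κ`, the mass is `M = m` and the threshold is `mε`.
  -- The exponent is therefore `-mε² / (4κ²)`, which explains the constant in `hsize`.
  have h := tail_opNorm_le w r (fun J e => Function.update J e.1 e.2)
    (fun J => ∑ k, A (J k) - (m : ℝ) • B) m (2 * κ) (m * ε)
    (fun J x y => by
      have h1 : ∀ i, inner ℝ (A i x) y = inner ℝ x (A i y) := fun i => hA i x y
      have h2 : inner ℝ (B x) y = inner ℝ x (B y) := hB x y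
      simp [inner_sub_left, inner_sub_right, sum_inner, inner_sum, inner_smul_left,
        inner_smul_right, h1, h2])
    hw hw1 hr (sum_update_symm r hsymm)
    (fun J => by
      rw [← hdrift J]
      refine Finset.sum_congr rfl fun e _ => ?_
      rw [sub_sub_sub_cancel_right, sum_sub_sum_update])
    hmass
    (fun J e => by
      rw [sub_sub_sub_cancel_right, sum_sub_sum_update]
      exact (norm_sub_le _ _).trans (by linarith [hAκ (J e.1), hAκ e.2]))
    (by positivity) hm' (by positivity)
  have hev : ∀ J : Fin m → Fin n, ε < ‖(1 / (m : ℝ)) • ∑ k, A (J k) - B‖ ↔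
      m * ε < ‖∑ k, A (J k) - (m : ℝ) • B‖ := by
    intro J
    have : ∑ k, A (J k) - (m : ℝ) • B = (m : ℝ) • ((1 / (m : ℝ)) • ∑ k, A (J k) - B) := by
      rw [smul_sub, smul_smul, mul_one_div_cancel hm'.ne', one_smul]
    rw [this, norm_smul, Real.norm_of_nonneg hm'.le, mul_lt_mul_iff_right₀ hm']
  simp only [hev]
  refine (le_of_eq_of_le (by congr!) h).trans ?_
  have h1 : Real.log (2 * Module.finrank ℝ E / δ) ≤ (m * ε) ^ 2 / (m * (2 * κ) ^ 2) := by
    rw [div_mul_eq_mul_div, div_le_iff₀ (by positivity)] at hsize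
    rw [le_div_iff₀ (by positivity)]
    have := mul_le_mul_of_nonneg_left hsize hm'.le
    linarith
  have h2 := Real.exp_le_exp.2 (neg_le_neg h1)
  rw [Real.exp_neg (Real.log _), Real.exp_log (by positivity)] at h2
  have h3 := mul_le_mul_of_nonneg_left h2 (by positivity : 0 ≤ 2 * (Module.finrank ℝ E : ℝ))
  refine h3.trans_eq ?_
  field_simp

open Classical in
-- The move redraws each position from `p` at rate one; its average displacement at position `k` is
-- `A (J k) - B`.
theorem tail_withReplacement (hm : 0 < m) (p : Fin n → ℝ) (hp : ∀ i, 0 ≤ p i)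
    (hp1 : ∑ i, p i = 1) (A : Fin n → E →L[ℝ] E) (B : E →L[ℝ] E)
    (hA : ∀ i, ((A i : E →L[ℝ] E) : E →ₗ[ℝ] E).IsSymmetric)
    (hB : (B : E →ₗ[ℝ] E).IsSymmetric) (hmean : ∑ i, p i • A i = B)
    {κ ε δ : ℝ} (hκ : 0 < κ) (hAκ : ∀ i, ‖A i‖ ≤ κ) (hε : 0 < ε) (hδ : 0 < δ)
    (hE : 0 < Module.finrank ℝ E)
    (hsize : 4 * κ ^ 2 / ε ^ 2 * Real.log (2 * Module.finrank ℝ E / δ) ≤ m) :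
    ∑ J, (if ε < ‖(1 / (m : ℝ)) • ∑ k, A (J k) - B‖ then withReplacement m p J else 0) ≤ δ := by
  refine tail_mean_le hm (withReplacement m p) (fun J e => withReplacement m p J * p e.2) A B hA hB
    (withReplacement_nonneg p hp) (sum_withReplacement p hp1)
    (fun J e => mul_nonneg (withReplacement_nonneg p hp J) (hp _))
    (withReplacement_update p) (fun J => ?_) (fun J => ?_) hκ hAκ hε hδ hE hsize
  · simp only [mul_smul, ← Finset.smul_sum]
    congr 1
    rw [Fintype.sum_prod_type]
    simp only [smul_sub, Finset.sum_sub_distrib, ← Finset.sum_smul, hp1, one_smul, hmean]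
    simp [← Nat.cast_smul_eq_nsmul ℝ]
  · rw [Fintype.sum_prod_type]
    simp only [← Finset.mul_sum, hp1]
    simp [mul_comm]

open Classical in
-- The move exchanges a drawn index for an undrawn one, each pair at rate `1/n` relative to the
-- weight of the list. This keeps lists injective and is its own reverse.
theorem tail_withoutReplacement (hm : 0 < m) (hmn : m ≤ n) (A : Fin n → E →L[ℝ] E)
    (B : E →L[ℝ] E) (hA : ∀ i, ((A i : E →L[ℝ] E) : E →ₗ[ℝ] E).IsSymmetric)
    (hB : (B : E →ₗ[ℝ] E).IsSymmetric) (hmean : ∑ i, A i = (n : ℝ) • B)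
    {κ ε δ : ℝ} (hκ : 0 < κ) (hAκ : ∀ i, ‖A i‖ ≤ κ) (hε : 0 < ε) (hδ : 0 < δ)
    (hE : 0 < Module.finrank ℝ E)
    (hsize : 4 * κ ^ 2 / ε ^ 2 * Real.log (2 * Module.finrank ℝ E / δ) ≤ m) :
    ∑ J, (if ε < ‖(1 / (m : ℝ)) • ∑ k, A (J k) - B‖ then withoutReplacement n m J else 0) ≤
      δ := by
  have hn : (0 : ℝ) < n := Nat.cast_pos.2 (hm.trans_le hmn)
  have hr0 : (0 : ℝ) ≤ 1 / (n.descFactorial m : ℝ) * (1 / (n : ℝ)) := by positivity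
  refine tail_mean_le hm (withoutReplacement n m)
    (fun J e => if Function.Injective J ∧ e.2 ∉ Set.range J then
      1 / (n.descFactorial m : ℝ) * (1 / (n : ℝ)) else 0) A B hA hB
    withoutReplacement_nonneg (sum_withoutReplacement hmn)
    (fun J e => by split_ifs <;> positivity)
    (fun J k i => ?_) (fun J => ?_) (fun J => ?_) hκ hAκ hε hδ hE hsize
  · have h : (Function.Injective (Function.update J k i) ∧
        J k ∉ Set.range (Function.update J k i)) ↔ (Function.Injective J ∧ i ∉ Set.range J) := by
      refine ⟨fun h => ?_, injective_update_of_notMem_range⟩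
      have := injective_update_of_notMem_range (k := k) h
      simpa using this
    simp only [h]
  · by_cases hJ : Function.Injective J
    · simp only [hJ, true_and, withoutReplacement, if_true, ite_smul, zero_smul, mul_smul]
      rw [Fintype.sum_prod_type]
      -- The sum over undrawn indices is the full sum minus the sum over drawn ones. Summed over
      -- positions, the latter part is antisymmetric in pairs of drawn indices and vanishes, leaving
      -- exactly the centred sum.
      simp only [sum_notMem_range hJ]
      simp only [← Finset.smul_sum, Finset.sum_sub_distrib, hmean, Finset.sum_const,
        Finset.card_univ, Fintype.card_fin, ← Nat.cast_smul_eq_nsmul ℝ]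
      have hz : (1 / (n : ℝ)) • (0 : E →L[ℝ] E) = 0 := smul_zero _
      have hz' : (1 / (n.descFactorial m : ℝ)) • (0 : E →L[ℝ] E) = 0 := smul_zero _
      rw [sub_self, hz, hz', sub_zero, ← smul_sub,
        smul_smul (1 / (n : ℝ)), one_div_mul_cancel hn.ne', one_smul]
    · simp [hJ, withoutReplacement]
  · by_cases hJ : Function.Injective J
    · simp only [hJ, true_and, withoutReplacement, if_true]
      rw [Fintype.sum_prod_type]
      have h1 : ∀ i : Fin n, (if i ∉ Set.range J then
          1 / (n.descFactorial m : ℝ) * (1 / (n : ℝ)) else 0) ≤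
          1 / (n.descFactorial m : ℝ) * (1 / (n : ℝ)) := fun i => by split_ifs <;> linarith
      refine (Finset.sum_le_sum fun k _ => Finset.sum_le_sum fun i _ => h1 i).trans_eq ?_
      simp only [Finset.sum_const, Finset.card_univ, Fintype.card_fin, nsmul_eq_mul]
      field_simp
    · simp [hJ, withoutReplacement]

end Tail

/-! ### Hessians of finite sums and of ridge functions -/

section Hessian

variable {d : ℕ}

/-- Symmetry of second derivatives needs only twice differentiability, not a continuous Hessian. -/
theorem hess_symm {f : Vec d → ℝ} (hf : TwiceDifferentiable f) (x : Vec d) :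
    ((hess f x : Vec d →L[ℝ] Vec d) : Vec d →ₗ[ℝ] Vec d).IsSymmetric := by
  let B : Vec d →L[ℝ] Vec d →L[ℝ] ℝ :=
    (isBoundedBilinearMap_inner (𝕜 := ℝ) (E := Vec d)).toContinuousLinearMap
  have hB : ∀ u v, B u v = inner ℝ u v := fun u v => rfl
  have h1 : ∀ y, HasFDerivAt f (B (gradient f y)) y := by
    intro y
    refine (hf.1 y).hasGradientAt.hasFDerivAt.congr_fderiv ?_
    ext v
    simp [hB]
  have h2 : HasFDerivAt (fun y => B (gradient f y)) (B ∘L hess f x) x :=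
    B.hasFDerivAt.comp x (hf.2 x).hasFDerivAt
  intro v w
  have h3 := second_derivative_symmetric h1 h2 v w
  simp only [ContinuousLinearMap.comp_apply, hB] at h3
  rw [real_inner_comm] at h3
  rw [real_inner_comm]
  exact h3.trans (real_inner_comm _ _)

theorem gradient_finiteSum {n : ℕ} {f : Fin n → Vec d → ℝ} (hf : ∀ i, TwiceDifferentiable (f i)) :
    gradient (finiteSum f) = fun x => (1 / (n : ℝ)) • ∑ i, gradient (f i) x := by
  refine gradient_eq fun x => ?_
  rw [hasGradientAt_iff_hasFDerivAt]
  have h : HasFDerivAt (finiteSum f) ((1 / (n : ℝ)) • ∑ i, fderiv ℝ (f i) x) x :=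
    (HasFDerivAt.fun_sum fun i _ => ((hf i).1 x).hasFDerivAt).const_mul (1 / (n : ℝ))
  refine h.congr_fderiv ?_
  ext v
  simp

theorem twiceDifferentiable_finiteSum {n : ℕ} {f : Fin n → Vec d → ℝ}
    (hf : ∀ i, TwiceDifferentiable (f i)) : TwiceDifferentiable (finiteSum f) := by
  constructor
  · exact (Differentiable.fun_sum fun i _ => (hf i).1).const_mul _
  · rw [gradient_finiteSum hf]
    exact (Differentiable.fun_sum fun i _ => (hf i).2).const_smul (1 / (n : ℝ))

theorem hess_finiteSum {n : ℕ} {f : Fin n → Vec d → ℝ} (hf : ∀ i, TwiceDifferentiable (f i))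
    (x : Vec d) : hess (finiteSum f) x = (1 / (n : ℝ)) • ∑ i, hess (f i) x := by
  unfold hess
  rw [gradient_finiteSum hf]
  exact ((HasFDerivAt.fun_sum fun i _ => ((hf i).2 x).hasFDerivAt).const_smul (1 / (n : ℝ))).fderiv

/-- The Hessian norm of a ridge function. -/
theorem abs_deriv_deriv_mul_norm_sq {f : Vec d → ℝ} (hf : TwiceDifferentiable f) (a : Vec d)
    (g : ℝ → ℝ) (hfg : ∀ x, f x = g (inner ℝ a x)) (x : Vec d) :
    |deriv (deriv g) (inner ℝ a x)| * ‖a‖ ^ 2 = ‖hess f x‖ := by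
  rcases eq_or_ne a 0 with rfl | ha
  · have h1 : f = fun _ => g 0 := by
      funext x; rw [hfg]; simp
    have h2 : gradient f = fun _ => 0 := by
      rw [h1]; exact gradient_eq fun x => hasGradientAt_const x _
    rw [hess, h2]
    simp
  · have hn : ‖a‖ ^ 2 ≠ 0 := by simpa using ha
    -- Restricting `f` to the line spanned by `a ≠ 0` recovers `g`, so `g` inherits its two
    -- derivatives from `f`.
    have hgf : g = fun u => f ((u / ‖a‖ ^ 2) • a) := by
      funext u
      rw [hfg, inner_smul_right, real_inner_self_eq_norm_sq, div_mul_cancel₀ _ hn]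
    have hc : ∀ u : ℝ, HasDerivAt (fun u : ℝ => (u / ‖a‖ ^ 2) • a) ((1 / ‖a‖ ^ 2) • a) u :=
      fun u => ((hasDerivAt_id u).div_const _).smul_const a
    have hg1 : Differentiable ℝ g := by
      rw [hgf]
      exact hf.1.comp fun u => (hc u).differentiableAt
    have hinner : ∀ y : Vec d, HasFDerivAt (fun y : Vec d => inner ℝ a y) (innerSL ℝ a) y :=
      fun y => (innerSL ℝ a).hasFDerivAt
    have hgrad : gradient f = fun y => deriv g (inner ℝ a y) • a := by
      refine gradient_eq fun y => ?_
      rw [hasGradientAt_iff_hasFDerivAt, show f = fun y => g (inner ℝ a y) from funext hfg]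
      refine ((hg1 _).hasDerivAt.comp_hasFDerivAt y (hinner y)).congr_fderiv ?_
      ext v
      simp
    have hg2 : Differentiable ℝ (deriv g) := by
      have : deriv g = fun u => inner ℝ a (gradient f ((u / ‖a‖ ^ 2) • a)) / ‖a‖ ^ 2 := by
        funext u
        rw [hgrad]
        simp only [inner_smul_right, real_inner_self_eq_norm_sq]
        rw [div_mul_cancel₀ _ hn, mul_div_assoc, div_self hn, mul_one]
      rw [this]
      exact ((differentiable_const a).inner ℝ
        (hf.2.comp fun u => (hc u).differentiableAt)).div_const _
    have hh : hess f x =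
        (deriv (deriv g) (inner ℝ a x) • innerSL ℝ a).smulRight a := by
      rw [hess, hgrad]
      exact (((hg2 _).hasDerivAt.comp_hasFDerivAt x (hinner x)).smul_const a).fderiv
    rw [hh, ContinuousLinearMap.norm_smulRight_apply, norm_smul, innerSL_apply_norm,
      Real.norm_eq_abs]
    ring

end Hessian

/-! ### Sampling guarantees for the two schemes -/

section Sampling

variable {d n m : ℕ}

theorem subsampledHess_eq (f : Fin n → Vec d → ℝ) (p : Fin n → ℝ) (J : Fin m → Fin n)
    (x : Vec d) :
    subsampledHess f p J x =
      (1 / (m : ℝ)) • ∑ k, (1 / ((n : ℝ) * p (J k))) • hess (f (J k)) x := by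
  unfold subsampledHess
  rw [Finset.smul_sum, Finset.smul_sum]
  refine Finset.sum_congr rfl fun k _ => ?_
  rw [smul_smul, smul_smul]
  congr 1
  rw [one_div_mul_one_div, one_div_mul_one_div]
  ring_nf

/-- Sampling guarantee: at every point the sub-sampled Hessian misses the tolerance `ε` with
probability at most `δ₀`. -/
def HasSamplingTail (f : Fin n → Vec d → ℝ) (ε δ₀ : ℝ) (p : Vec d → Fin n → ℝ)
    (law : Vec d → (Fin m → Fin n) → ℝ) : Prop :=
  open Classical in
  ∀ x, ∑ J, (if ε < ‖subsampledHess f (p x) J x - hess (finiteSum f) x‖ then law x J else 0) ≤ δ₀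

/-- Unbiasedness of the estimator. An index of weight zero is never drawn, so its Hessian must
vanish for nothing to be lost. -/
theorem weighted_hess_mean {f : Fin n → Vec d → ℝ} (hf : ∀ i, TwiceDifferentiable (f i))
    (p : Fin n → ℝ) (x : Vec d) (hp : ∀ i, p i = 0 → hess (f i) x = 0) :
    ∑ i, p i • ((1 / ((n : ℝ) * p i)) • hess (f i) x) = hess (finiteSum f) x := by
  rw [hess_finiteSum hf, Finset.smul_sum]
  refine Finset.sum_congr rfl fun i _ => ?_
  by_cases h : p i = 0
  · have hz : ∀ c : ℝ, c • (0 : Vec d →L[ℝ] Vec d) = 0 := fun c => by ext v; simp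
    rw [hp i h, hz, hz, hz]
  · rw [smul_smul]
    congr 1
    rw [one_div, mul_inv, mul_left_comm, mul_inv_cancel₀ h, mul_one, one_div]

theorem weighted_hess_symm {f : Fin n → Vec d → ℝ} (hf : ∀ i, TwiceDifferentiable (f i))
    (c : ℝ) (x : Vec d) (i : Fin n) :
    ((c • hess (f i) x : Vec d →L[ℝ] Vec d) : Vec d →ₗ[ℝ] Vec d).IsSymmetric := by
  intro v w
  have : inner ℝ (hess (f i) x v) w = inner ℝ v (hess (f i) x w) := hess_symm (hf i) x v w
  simp [inner_smul_left, inner_smul_right, this]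

/-- The deviation vanishes when all Hessians do. -/
theorem sampling_tail_of_hess_zero {f : Fin n → Vec d → ℝ}
    (hf : ∀ i, TwiceDifferentiable (f i)) (p : Fin n → ℝ) (x : Vec d)
    (h : ∀ i, hess (f i) x = 0) (J : Fin m → Fin n) :
    subsampledHess f p J x - hess (finiteSum f) x = 0 := by
  rw [subsampledHess_eq, hess_finiteSum hf]
  have hz : ∀ c : ℝ, c • (0 : Vec d →L[ℝ] Vec d) = 0 := fun c => by ext v; simp
  simp only [h, hz, Finset.sum_const_zero, sub_zero]

theorem IsUniformSampling.hasSamplingTail (hd : 0 < d) (hn : 0 < n) (hm : 0 < m)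
    {f : Fin n → Vec d → ℝ} (hf : ∀ i, TwiceDifferentiable (f i)) {K : Fin n → ℝ}
    (hK : ∀ i x, ‖hess (f i) x‖ ≤ K i) {KH ε δ₀ : ℝ} (hε : 0 < ε) (hδ : 0 < δ₀) (hδ1 : δ₀ ≤ 1)
    {p : Vec d → Fin n → ℝ} {law : Vec d → (Fin m → Fin n) → ℝ}
    (h : IsUniformSampling m K KH ε δ₀ p law) : HasSamplingTail f ε δ₀ p law := by
  classical
  obtain ⟨hp, hlaw, -, hsize⟩ := h
  intro x
  have hn' : (0 : ℝ) < n := Nat.cast_pos.2 hn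
  have hd' : (1 : ℝ) ≤ d := Nat.one_le_cast.2 hd
  have hKm : ∀ i, ‖hess (f i) x‖ ≤ ⨆ i, K i := fun i =>
    (hK i x).trans (le_ciSup (Set.finite_range K).bddAbove i)
  set κ := ⨆ i, K i with hκd
  have hκ0 : 0 ≤ κ := (norm_nonneg _).trans (hKm ⟨0, hn⟩)
  -- If `κ = 0` the tail bound is unavailable, but every Hessian vanishes and there is no deviation.
  rcases hκ0.eq_or_lt with h0 | hκ
  · have hz : ∀ i, hess (f i) x = 0 := fun i => norm_le_zero_iff.1 (h0 ▸ hKm i)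
    simp only [sampling_tail_of_hess_zero hf _ x hz, norm_zero, not_lt.2 hε.le, if_false,
      Finset.sum_const_zero]
    exact hδ.le
  have hlog : 0 ≤ Real.log (2 * d / δ₀) := by
    refine Real.log_nonneg ?_
    rw [le_div_iff₀ hδ]; linarith
  -- The constant `4` already suffices; the assumed `16` leaves room.
  have hsize' : 4 * κ ^ 2 / ε ^ 2 * Real.log (2 * Module.finrank ℝ (Vec d) / δ₀) ≤ m := by
    rw [finrank_euclideanSpace_fin]
    refine le_trans ?_ hsize
    refine mul_le_mul_of_nonneg_right ?_ hlog
    refine div_le_div_of_nonneg_right ?_ (by positivity)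
    nlinarith [sq_nonneg κ]
  have hE : 0 < Module.finrank ℝ (Vec d) := by rwa [finrank_euclideanSpace_fin]
  have hone : ∀ i : Fin n, 1 / ((n : ℝ) * uniformWeights n i) = 1 := by
    intro i; unfold uniformWeights; rw [mul_one_div_cancel hn'.ne', div_one]
  simp only [subsampledHess_eq, hp, hone, one_smul]
  have hFs := hess_symm (twiceDifferentiable_finiteSum hf) x
  rcases hlaw with hl | ⟨hmn, hl⟩
  · simp only [hl]
    refine le_of_eq_of_le (by congr!) (tail_withReplacement hm (uniformWeights n)
      (fun i => by unfold uniformWeights; positivity)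
      (by simp [uniformWeights, hn'.ne']) (fun i => hess (f i) x) _
      (fun i => hess_symm (hf i) x) hFs ?_ hκ hKm hε hδ hE hsize')
    rw [hess_finiteSum hf, Finset.smul_sum]
    rfl
  · simp only [hl]
    refine le_of_eq_of_le (by congr!) (tail_withoutReplacement hm hmn (fun i => hess (f i) x) _
      (fun i => hess_symm (hf i) x) hFs ?_ hκ hKm hε hδ hE hsize')
    rw [hess_finiteSum hf, smul_smul, mul_one_div_cancel hn'.ne', one_smul]

/-- Importance sampling by Hessian norm: the weights do not depend on the chosen ridge
representation. -/
theorem curvatureWeights_eq {f : Fin n → Vec d → ℝ} (hf : ∀ i, TwiceDifferentiable (f i))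
    (a : Fin n → Vec d) (g : Fin n → ℝ → ℝ) (hfg : ∀ i x, f i x = g i (inner ℝ (a i) x))
    (x : Vec d) (i : Fin n) :
    curvatureWeights a g x i = if ∑ j, ‖hess (f j) x‖ = 0 then uniformWeights n i
      else ‖hess (f i) x‖ / ∑ j, ‖hess (f j) x‖ := by
  unfold curvatureWeights
  simp only [fun j => abs_deriv_deriv_mul_norm_sq (hf j) (a j) (g j) (hfg j) x]

theorem IsNonuniformSampling.hasSamplingTail (hd : 0 < d) (hm : 0 < m)
    {f : Fin n → Vec d → ℝ} (hf : ∀ i, TwiceDifferentiable (f i)) {K : Fin n → ℝ}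
    (hK : ∀ i x, ‖hess (f i) x‖ ≤ K i) {KH ε δ₀ : ℝ} (hε : 0 < ε) (hδ : 0 < δ₀) (hδ1 : δ₀ ≤ 1)
    {p : Vec d → Fin n → ℝ} {law : Vec d → (Fin m → Fin n) → ℝ}
    (h : IsNonuniformSampling m f K KH ε δ₀ p law) : HasSamplingTail f ε δ₀ p law := by
  classical
  obtain ⟨a, g, hfg, hp, hlaw, -, hsize⟩ := h
  intro x
  have hd' : (1 : ℝ) ≤ d := Nat.one_le_cast.2 hd
  have hlog : 0 ≤ Real.log (2 * d / δ₀) := by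
    refine Real.log_nonneg ?_
    rw [le_div_iff₀ hδ]; linarith
  have hcw : curvatureWeights a g x = fun i => if ∑ j, ‖hess (f j) x‖ = 0 then uniformWeights n i
      else ‖hess (f i) x‖ / ∑ j, ‖hess (f j) x‖ :=
    funext fun i => curvatureWeights_eq hf a g hfg x i
  set hsum := ∑ j, ‖hess (f j) x‖ with hs
  have hs0 : 0 ≤ hsum := Finset.sum_nonneg fun i _ => norm_nonneg _
  rcases hs0.eq_or_lt with h0 | hpos
  · have hz : ∀ i, hess (f i) x = 0 := fun i => by
      have := (Finset.sum_eq_zero_iff_of_nonneg (fun i _ => norm_nonneg (hess (f i) x))).1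
        h0.symm i (Finset.mem_univ i)
      exact norm_eq_zero.1 this
    simp only [sampling_tail_of_hess_zero hf _ x hz, norm_zero, not_lt.2 hε.le, if_false,
      Finset.sum_const_zero]
    exact hδ.le
  have hn : 0 < n := by
    rcases Nat.eq_zero_or_pos n with rfl | hn
    · simp [hs] at hpos
    · exact hn
  have hn' : (0 : ℝ) < n := Nat.cast_pos.2 hn
  simp only [if_neg hpos.ne'] at hcw
  -- The common norm bound for the rescaled Hessians is the average Hessian norm at `x`, which is at
  -- most `K̂`.
  have hκ : 0 < 1 / (n : ℝ) * hsum := by positivity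
  have hκK : 1 / (n : ℝ) * hsum ≤ 1 / (n : ℝ) * ∑ i, K i :=
    mul_le_mul_of_nonneg_left (Finset.sum_le_sum fun i _ => hK i x) (by positivity)
  have hsize' : 4 * (1 / (n : ℝ) * hsum) ^ 2 / ε ^ 2 *
      Real.log (2 * Module.finrank ℝ (Vec d) / δ₀) ≤ m := by
    rw [finrank_euclideanSpace_fin]
    refine le_trans ?_ hsize
    refine mul_le_mul_of_nonneg_right ?_ hlog
    refine div_le_div_of_nonneg_right ?_ (by positivity)
    have := pow_le_pow_left₀ hκ.le hκK 2
    linarith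
  have hE : 0 < Module.finrank ℝ (Vec d) := by rwa [finrank_euclideanSpace_fin]
  simp only [subsampledHess_eq, hp, hlaw, hcw]
  refine le_of_eq_of_le (by congr!) (tail_withReplacement hm
    (fun i => ‖hess (f i) x‖ / hsum) (fun i => by positivity)
    (by rw [← Finset.sum_div]; exact div_self hpos.ne')
    (fun i => (1 / ((n : ℝ) * (‖hess (f i) x‖ / hsum))) • hess (f i) x) _
    (fun i => weighted_hess_symm hf _ x i)
    (hess_symm (twiceDifferentiable_finiteSum hf) x)
    (weighted_hess_mean hf (fun i => ‖hess (f i) x‖ / hsum) x fun i hi => ?_)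
    hκ (fun i => ?_) hε hδ hE hsize')
  · rcases div_eq_zero_iff.1 hi with h | h
    · exact norm_eq_zero.1 h
    · exact absurd h hpos.ne'
  · have hc : ∀ b : ℝ, 0 ≤ b → 1 / ((n : ℝ) * (b / hsum)) * b ≤ 1 / (n : ℝ) * hsum := by
      intro b hb
      rcases hb.eq_or_lt with rfl | hb
      · rw [mul_zero]; exact hκ.le
      · refine le_of_eq ?_
        field_simp
    have hc0 : 0 ≤ 1 / ((n : ℝ) * (‖hess (f i) x‖ / hsum)) := by positivity
    calc ‖(1 / ((n : ℝ) * (‖hess (f i) x‖ / hsum))) • hess (f i) x‖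
        = 1 / ((n : ℝ) * (‖hess (f i) x‖ / hsum)) * ‖hess (f i) x‖ := by
          rw [norm_smul, Real.norm_of_nonneg hc0]
      _ ≤ _ := hc _ (norm_nonneg _)

end Sampling

/-! ### Perturbation of the least eigenvalue -/

section LambdaMin

variable {d : ℕ}

theorem abs_rayleighQuotient_le (A : Vec d →L[ℝ] Vec d) (v : Vec d) :
    |A.rayleighQuotient v| ≤ ‖A‖ := by
  simp only [ContinuousLinearMap.rayleighQuotient, ContinuousLinearMap.reApplyInnerSelf_apply,
    RCLike.re_to_real]
  rw [abs_div, abs_of_nonneg (sq_nonneg ‖v‖)]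
  refine div_le_of_le_mul₀ (sq_nonneg _) (norm_nonneg _) ?_
  refine (abs_real_inner_le_norm _ _).trans ?_
  nlinarith [A.le_opNorm v, norm_nonneg v]

/-- Weyl's inequality for the least eigenvalue. -/
theorem lambdaMin_le_add (hd : 0 < d) (A B : Vec d →L[ℝ] Vec d) :
    lambdaMin A ≤ lambdaMin B + ‖A - B‖ := by
  have : Nonempty (Fin d) := ⟨⟨0, hd⟩⟩
  have : Nontrivial (Vec d) := inferInstance
  obtain ⟨v₀, hv₀⟩ := exists_ne (0 : Vec d)
  have : Nonempty {v : Vec d // v ≠ 0} := ⟨⟨v₀, hv₀⟩⟩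
  have hbdd : BddBelow (Set.range fun v : {v : Vec d // v ≠ 0} => A.rayleighQuotient v) := by
    refine ⟨-‖A‖, ?_⟩
    rintro _ ⟨w, rfl⟩
    exact neg_le_of_abs_le (abs_rayleighQuotient_le A w)
  rw [← sub_le_iff_le_add]
  refine le_ciInf fun v => ?_
  have h1 : lambdaMin A ≤ A.rayleighQuotient v := ciInf_le hbdd v
  have h2 : A.rayleighQuotient v - B.rayleighQuotient v = (A - B).rayleighQuotient v := by
    simp only [ContinuousLinearMap.rayleighQuotient, ContinuousLinearMap.reApplyInnerSelf_apply,
      RCLike.re_to_real, sub_apply, inner_sub_left, sub_div]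
  linarith [le_of_abs_le (abs_rayleighQuotient_le (A - B) v)]

end LambdaMin

/-! ### Actual decrease against model decrease -/

section Descent

variable {d : ℕ}

/-- Taylor's inequality for a Hessian that is Lipschitz along a segment. -/
theorem le_cubic_taylor {F : Vec d → ℝ} (hF : TwiceDifferentiable F) (x s : Vec d) {L : ℝ}
    (hL : ∀ y ∈ segment ℝ x (x + s), ‖hess F y - hess F x‖ ≤ L * ‖y - x‖) :
    F (x + s) ≤ F x + inner ℝ (gradient F x) s + 1 / 2 * inner ℝ s (hess F x s) +
      L / 6 * ‖s‖ ^ 3 := by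
  have hline : ∀ τ : ℝ, HasDerivAt (fun τ : ℝ => x + τ • s) s τ := fun τ => by
    simpa using ((hasDerivAt_id τ).smul_const s).const_add x
  set q := inner ℝ s (hess F x s) with hq
  -- `φ` is `F` along the segment minus the linear, quadratic and cubic terms of the bound. Its
  -- second derivative is nonpositive on `[0, 1]` and `φ' 0 = 0`, so two monotonicity arguments
  -- replace integration of the Hessian.
  set φ' : ℝ → ℝ := fun τ => inner ℝ (gradient F (x + τ • s)) s - inner ℝ (gradient F x) s -
    τ * q - L / 2 * τ ^ 2 * ‖s‖ ^ 3 with hφ'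
  set φ : ℝ → ℝ := fun τ => F (x + τ • s) - τ * inner ℝ (gradient F x) s - τ ^ 2 / 2 * q -
    L / 6 * τ ^ 3 * ‖s‖ ^ 3 with hφ
  have h1 : ∀ τ, HasDerivAt φ (φ' τ) τ := by
    intro τ
    have a := (hF.1 (x + τ • s)).hasGradientAt.hasFDerivAt.comp_hasDerivAt τ (hline τ)
    have b := (hasDerivAt_id τ).mul_const (inner ℝ (gradient F x) s)
    have c := ((hasDerivAt_pow 2 τ).div_const 2).mul_const q
    have e := ((hasDerivAt_pow 3 τ).const_mul (L / 6)).mul_const (‖s‖ ^ 3)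
    refine (((a.sub b).sub c).sub e).congr_deriv ?_
    simp [hφ']
    left
    ring
  have h2 : ∀ τ, HasDerivAt φ' (inner ℝ (hess F (x + τ • s) s) s - q - L * τ * ‖s‖ ^ 3) τ := by
    intro τ
    have a := ((hF.2 (x + τ • s)).hasFDerivAt.comp_hasDerivAt τ (hline τ)).inner ℝ
      (hasDerivAt_const τ s)
    have b := (hasDerivAt_id τ).mul_const q
    have e := ((hasDerivAt_pow 2 τ).const_mul (L / 2)).mul_const (‖s‖ ^ 3)
    refine (((a.sub_const (inner ℝ (gradient F x) s)).sub b).sub e).congr_deriv ?_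
    simp [hess]
    left
    ring
  have h3 : ∀ τ ∈ Set.Icc (0 : ℝ) 1,
      inner ℝ (hess F (x + τ • s) s) s - q - L * τ * ‖s‖ ^ 3 ≤ 0 := by
    intro τ hτ
    have hy : x + τ • s ∈ segment ℝ x (x + s) := by
      rw [segment_eq_image']
      exact ⟨τ, hτ, by simp⟩
    have a := hL _ hy
    rw [add_sub_cancel_left, norm_smul, Real.norm_of_nonneg hτ.1] at a
    have b : inner ℝ (hess F (x + τ • s) s) s - q =
        inner ℝ ((hess F (x + τ • s) - hess F x) s) s := by
      rw [hq, sub_apply, inner_sub_left, real_inner_comm s (hess F x s)]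
    have c := (real_inner_le_norm ((hess F (x + τ • s) - hess F x) s) s).trans
      (mul_le_mul_of_nonneg_right ((hess F (x + τ • s) - hess F x).le_opNorm s) (norm_nonneg s))
    have e : ‖hess F (x + τ • s) - hess F x‖ * ‖s‖ * ‖s‖ ≤ L * (τ * ‖s‖) * ‖s‖ * ‖s‖ := by
      gcongr
    rw [b]
    linarith
  have hanti' : AntitoneOn φ' (Set.Icc 0 1) := by
    refine antitoneOn_of_deriv_nonpos (convex_Icc 0 1)
      (fun v _ => (h2 v).continuousAt.continuousWithinAt)
      (fun v _ => (h2 v).differentiableAt.differentiableWithinAt) fun v hv => ?_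
    rw [(h2 v).deriv]
    exact h3 v (interior_subset hv)
  have hanti : AntitoneOn φ (Set.Icc 0 1) := by
    refine antitoneOn_of_deriv_nonpos (convex_Icc 0 1)
      (fun v _ => (h1 v).continuousAt.continuousWithinAt)
      (fun v _ => (h1 v).differentiableAt.differentiableWithinAt) fun v hv => ?_
    rw [(h1 v).deriv]
    have hv' := interior_subset hv
    have := hanti' (Set.left_mem_Icc.2 zero_le_one) hv' hv'.1
    have h0 : φ' 0 = 0 := by simp [hφ']
    linarith
  have h := hanti (Set.left_mem_Icc.2 zero_le_one) (Set.right_mem_Icc.2 zero_le_one) zero_le_one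
  simp only [hφ, one_smul, zero_smul, add_zero] at h
  linarith

/-- The actual decrease falls short of the predicted one by at most `2 ε³ / σ²`. -/
theorem decrease_ge_model {F : Vec d → ℝ} (hF : TwiceDifferentiable F) (x s : Vec d)
    (H : Vec d →L[ℝ] Vec d) {L σ ε : ℝ} (hσ0 : 0 < σ) (hσ : 2 * L ≤ σ) (hε : 0 ≤ ε)
    (hH : ‖H - hess F x‖ ≤ ε)
    (hL : ∀ y ∈ segment ℝ x (x + s), ‖hess F y - hess F x‖ ≤ L * ‖y - x‖) :
    -cubicModel (gradient F x) H σ s - 2 * ε ^ 3 / σ ^ 2 ≤ F x - F (x + s) := by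
  have h1 := le_cubic_taylor hF x s hL
  have h2 : inner ℝ s (hess F x s) - inner ℝ s (H s) ≤ ε * ‖s‖ ^ 2 := by
    have : inner ℝ s (hess F x s) - inner ℝ s (H s) = inner ℝ s ((hess F x - H) s) := by
      rw [sub_apply, inner_sub_right]
    rw [this]
    refine (real_inner_le_norm _ _).trans ?_
    have a := (hess F x - H).le_opNorm s
    rw [norm_sub_rev] at hH
    have b : ‖(hess F x - H) s‖ ≤ ε * ‖s‖ :=
      a.trans (mul_le_mul_of_nonneg_right hH (norm_nonneg _))
    calc ‖s‖ * ‖(hess F x - H) s‖ ≤ ‖s‖ * (ε * ‖s‖) := by gcongr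
      _ = _ := by ring
  -- For `‖s‖ ≥ 2ε/σ` the left side is nonpositive. Otherwise drop the cubic term and insert `‖s‖ ≤
  -- 2ε/σ`.
  have h3 : ε / 2 * ‖s‖ ^ 2 - σ / 4 * ‖s‖ ^ 3 ≤ 2 * ε ^ 3 / σ ^ 2 := by
    have hr := norm_nonneg s
    generalize ‖s‖ = r at hr
    rw [le_div_iff₀ (by positivity)]
    rcases le_total (2 * ε) (σ * r) with h | h
    · have : (ε / 2 * r ^ 2 - σ / 4 * r ^ 3) * σ ^ 2 =
          -(r ^ 2 * σ ^ 2 / 4 * (σ * r - 2 * ε)) := by ring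
      rw [this]
      have a : 0 ≤ r ^ 2 * σ ^ 2 / 4 * (σ * r - 2 * ε) :=
        mul_nonneg (by positivity) (sub_nonneg.2 h)
      have b : 0 ≤ 2 * ε ^ 3 := by positivity
      linarith
    · have a : (σ * r) ^ 2 ≤ (2 * ε) ^ 2 := pow_le_pow_left₀ (by positivity) h 2
      have b := mul_le_mul_of_nonneg_left a (by positivity : 0 ≤ ε / 2)
      have c : 0 ≤ σ / 4 * r ^ 3 * σ ^ 2 := by positivity
      linarith
  -- From `L ≤ σ/2`: `σ/12 - σ/3 = -σ/4`.
  have h4 : L / 6 * ‖s‖ ^ 3 - σ / 3 * ‖s‖ ^ 3 ≤ -(σ / 4 * ‖s‖ ^ 3) := by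
    have := mul_le_mul_of_nonneg_right hσ (by positivity : 0 ≤ ‖s‖ ^ 3)
    linarith
  unfold cubicModel
  linarith

/-- Acceptance needs only that the shortfall be at most `1 - η` times some positive lower bound `P`
of the model decrease. -/
theorem eta_le_decreaseRatio {F : Vec d → ℝ} (hF : TwiceDifferentiable F) (x s : Vec d)
    (H : Vec d →L[ℝ] Vec d) {L σ ε η P : ℝ} (hσ0 : 0 < σ) (hσ : 2 * L ≤ σ) (hε : 0 ≤ ε)
    (hH : ‖H - hess F x‖ ≤ ε)
    (hL : ∀ y ∈ segment ℝ x (x + s), ‖hess F y - hess F x‖ ≤ L * ‖y - x‖)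
    (hP : 0 < P) (hm : P ≤ -cubicModel (gradient F x) H σ s) (hη : η ≤ 1)
    (hεP : 2 * ε ^ 3 / σ ^ 2 ≤ (1 - η) * P) :
    η ≤ decreaseRatio F x H σ s := by
  have h := decrease_ge_model hF x s H hσ0 hσ hε hH hL
  unfold decreaseRatio
  rw [le_div_iff₀ (hP.trans_le hm)]
  have := mul_le_mul_of_nonneg_left hm (sub_nonneg.2 hη)
  linarith

theorem two_sqrt_three_le : 2 * Real.sqrt 3 ≤ 4 := by
  have : Real.sqrt 3 ≤ 2 := by
    rw [Real.sqrt_le_left (by norm_num)]; norm_num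
  linarith

/-- The model decrease guaranteed at an iterate which is not returned. -/
noncomputable def modelDecrease (ν KH εg εH σ : ℝ) : ℝ :=
  min (εg / 4 * min (εg / KH) (Real.sqrt (εg / σ))) (ν ^ 3 * εH ^ 3 / (6 * σ ^ 2))

theorem modelDecrease_pos {ν KH εg εH σ : ℝ} (hν : 0 < ν) (hKH : 0 < KH) (hεg : 0 < εg)
    (hεH : 0 < εH) (hσ : 0 < σ) : 0 < modelDecrease ν KH εg εH σ := by
  unfold modelDecrease
  refine lt_min (mul_pos (by positivity) (lt_min (by positivity) ?_)) (by positivity)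
  exact Real.sqrt_pos.2 (by positivity)

/-- A failed test leaves either a large gradient, served by the Cauchy step, or an eigenvalue below
`-εH`, served by the eigenstep. Only the second entry of each maximum is used, with `2√3` rounded up
to `4`. -/
theorem modelDecrease_le {F : Vec d → ℝ} {ν KH εg εH σ : ℝ} (hν : 0 < ν) (hKH : 0 < KH)
    (hεg : 0 < εg) (hεH : 0 < εH) (hσ : 0 < σ) {x s : Vec d} {H : Vec d →L[ℝ] Vec d}
    (hs : SufficientDescent ν KH (gradient F x) H σ s) (hcont : ¬ Stops F εg εH x H) :
    modelDecrease ν KH εg εH σ ≤ -cubicModel (gradient F x) H σ s := by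
  obtain ⟨⟨sC, -, h1, h2⟩, h3⟩ := hs
  by_cases hg : ‖gradient F x‖ ≤ εg
  · have hl : lambdaMin H < -εH := by
      by_contra hc
      exact hcont ⟨hg, not_lt.1 hc⟩
    have hl0 : lambdaMin H < 0 := by linarith
    obtain ⟨sE, -, -, h4, h5⟩ := h3 hl0
    refine (min_le_right _ _).trans ?_
    refine le_trans ?_ (h5.le.trans h4.le)
    have ha : εH ≤ |lambdaMin H| := by rw [abs_of_neg hl0]; linarith
    calc ν ^ 3 * εH ^ 3 / (6 * σ ^ 2) ≤ ν ^ 3 * |lambdaMin H| ^ 3 / (6 * σ ^ 2) := by gcongr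
      _ = ν * |lambdaMin H| / 6 * (ν ^ 2 * |lambdaMin H| ^ 2 / σ ^ 2) := by
          field_simp
      _ ≤ _ := by
          refine mul_le_mul_of_nonneg_left (le_max_right _ _) (by positivity)
  · push Not at hg
    refine (min_le_left _ _).trans ?_
    refine le_trans ?_ (h2.le.trans h1.le)
    refine le_trans ?_ (le_max_right _ _)
    have h0 : 0 < ‖gradient F x‖ := hεg.trans hg
    have hc : εg / 4 ≤ ‖gradient F x‖ / (2 * Real.sqrt 3) := by
      have := two_sqrt_three_le
      have h3 : 0 < Real.sqrt 3 := Real.sqrt_pos.2 (by norm_num)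
      gcongr
    refine mul_le_mul hc ?_ (le_min (by positivity) (Real.sqrt_nonneg _)) (by positivity)
    exact min_le_min (by gcongr) (Real.sqrt_le_sqrt (by gcongr))

/-- Within the allowed tolerance the Hessian error is dominated by the model decrease. -/
theorem tolerance_cubed_le {η ν L KH εg εH σ ε : ℝ} (hη0 : 0 < η) (hη : η < 1) (hν : 0 < ν)
    (hL : 0 < L) (hKH : 0 < KH) (hεg : 0 < εg) (hεH : 0 < εH) (hσ : 2 * L ≤ σ) (hε : 0 < ε)
    (hεm : ε ≤ maxTolerance η ν L KH εg εH) :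
    2 * ε ^ 3 / σ ^ 2 ≤ (1 - η) * modelDecrease ν KH εg εH σ := by
  have hσ0 : 0 < σ := by linarith
  have hη1 : 0 < 1 - η := sub_pos.2 hη
  set Q := Real.sqrt (KH ^ 2 + 8 * L * εg) - KH with hQ
  have hQ0 : 0 ≤ Q := sub_nonneg.2 (Real.le_sqrt_of_sq_le (by nlinarith [mul_pos hL hεg]))
  -- `Q` is the nonnegative root of this quadratic. As `8Lεg ≤ 4σεg`, it satisfies both `Q² ≤ 4σεg`
  -- and `KH * Q ≤ 2σεg`, which serve the two gradient terms of the model decrease.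
  have hQ2 : Q ^ 2 + 2 * KH * Q = 8 * L * εg := by
    have := Real.sq_sqrt (by positivity : 0 ≤ KH ^ 2 + 8 * L * εg)
    rw [hQ]; nlinarith
  have hLσ : 8 * L * εg ≤ 4 * σ * εg := by nlinarith
  -- One factor of `ε` takes the bound carrying `1 - η`, the other two take the bound without it.
  have hcube : ∀ b Y : ℝ, 0 ≤ b → 0 ≤ Y → ε ≤ b * Y → ε ≤ (1 - η) * (2 * b) * Y →
      ε ^ 3 ≤ (1 - η) * (2 * b) * b ^ 2 * Y ^ 3 := by
    intro b Y hb hY h1 h2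
    calc ε ^ 3 = ε * ε ^ 2 := by ring
      _ ≤ ((1 - η) * (2 * b) * Y) * (b * Y) ^ 2 :=
          mul_le_mul h2 (pow_le_pow_left₀ hε.le h1 2) (by positivity) (by positivity)
      _ = _ := by ring
  have e1 : ε ≤ 1 / 12 * Q := hεm.trans ((min_le_left _ _).trans
    (mul_le_mul_of_nonneg_right (min_le_left _ _) hQ0))
  have e2 : ε ≤ (1 - η) * (2 * (1 / 12)) * Q := (hεm.trans ((min_le_left _ _).trans
    (mul_le_mul_of_nonneg_right (min_le_right _ _) hQ0))).trans_eq (by ring)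
  have e3 : ε ≤ 1 / 6 * (ν * εH) := (hεm.trans ((min_le_right _ _).trans
    (mul_le_mul_of_nonneg_right (mul_le_mul_of_nonneg_right (min_le_left _ _) hν.le)
      hεH.le))).trans_eq (by ring)
  have e4 : ε ≤ (1 - η) * (2 * (1 / 6)) * (ν * εH) := (hεm.trans ((min_le_right _ _).trans
    (mul_le_mul_of_nonneg_right (mul_le_mul_of_nonneg_right (min_le_right _ _) hν.le)
      hεH.le))).trans_eq (by ring)
  have c1 := hcube (1 / 12) Q (by norm_num) hQ0 e1 e2
  have c2 := hcube (1 / 6) (ν * εH) (by norm_num) (by positivity) e3 e4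
  unfold modelDecrease
  rw [mul_min_of_nonneg _ _ hη1.le, mul_min_of_nonneg _ _ (by positivity : 0 ≤ εg / 4),
    mul_min_of_nonneg _ _ hη1.le]
  refine le_min (le_min ?_ ?_) ?_
  · have h1 : KH * Q ^ 3 ≤ 8 * σ ^ 2 * εg ^ 2 := by
      have a : Q ^ 2 ≤ 4 * σ * εg := by nlinarith [mul_nonneg hKH.le hQ0]
      have b : KH * Q ≤ 2 * σ * εg := by nlinarith [sq_nonneg Q]
      calc KH * Q ^ 3 = (KH * Q) * Q ^ 2 := by ring
        _ ≤ (2 * σ * εg) * (4 * σ * εg) := mul_le_mul b a (by positivity) (by positivity)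
        _ = _ := by ring
    rw [div_le_iff₀ (by positivity)]
    have h2 : (1 - η) * (εg / 4 * (εg / KH)) * σ ^ 2 = (1 - η) * (σ ^ 2 * εg ^ 2 / 4) / KH := by
      field_simp
    rw [h2, le_div_iff₀ hKH]
    have h3 := mul_le_mul_of_nonneg_left h1 hη1.le
    have h4 := mul_le_mul_of_nonneg_left c1 hKH.le
    have h5 : 0 ≤ (1 - η) * (σ ^ 2 * εg ^ 2) := by positivity
    nlinarith
  · set r := Real.sqrt (εg / σ) with hr
    have hr0 : 0 ≤ r := Real.sqrt_nonneg _
    have hr2 : σ * r ^ 2 = εg := by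
      rw [hr, Real.sq_sqrt (by positivity)]; field_simp
    have h1 : Q ≤ 2 * (σ * r) := by
      refine le_of_sq_le_sq ?_ (by positivity)
      have : (2 * (σ * r)) ^ 2 = 4 * σ * εg := by rw [← hr2]; ring
      nlinarith [mul_nonneg hKH.le hQ0]
    have h2 : Q ^ 3 ≤ (2 * (σ * r)) ^ 3 := pow_le_pow_left₀ hQ0 h1 3
    rw [div_le_iff₀ (by positivity)]
    have h3 := mul_le_mul_of_nonneg_left h2 hη1.le
    have h4 : (1 - η) * (εg / 4 * r) * σ ^ 2 = (1 - η) * (σ * r) ^ 3 / 4 := by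
      rw [← hr2]; ring
    rw [h4]
    have h5 : 0 ≤ (1 - η) * (σ * r) ^ 3 := by positivity
    nlinarith
  · rw [div_le_iff₀ (by positivity)]
    have h1 : (1 - η) * (ν ^ 3 * εH ^ 3 / (6 * σ ^ 2)) * σ ^ 2 = (1 - η) * (ν * εH) ^ 3 / 6 := by
      field_simp
    rw [h1]
    have h5 : 0 ≤ (1 - η) * (ν * εH) ^ 3 := by positivity
    nlinarith

/-- A decrease uniform over `σ ≤ σm`. The square root term is of order `εg^(3/2)`, which dominates
`εg²` because `εg < 1`. -/
theorem le_modelDecrease {ν KH εg εH σ σm : ℝ} (hν : 0 < ν) (hKH : 0 < KH)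
    (hεg : 0 < εg ∧ εg < 1) (hεH : 0 < εH) (hσ : 0 < σ) (hσm : σ ≤ σm) :
    modelDecrease ν KH 1 1 σm * min (εg ^ 2) (εH ^ 3) ≤ modelDecrease ν KH εg εH σ := by
  have hσm0 : 0 < σm := hσ.trans_le hσm
  have hg0 := hεg.1
  have hmin0 : 0 ≤ min (εg ^ 2) (εH ^ 3) := le_min (by positivity) (by positivity)
  refine le_min ?_ ?_
  · have h1 : Real.sqrt (1 / σm) * εg ≤ Real.sqrt (εg / σ) := by
      refine Real.le_sqrt_of_sq_le ?_
      rw [mul_pow, Real.sq_sqrt (by positivity)]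
      have : εg ^ 2 ≤ εg := by nlinarith [hεg.2]
      calc 1 / σm * εg ^ 2 ≤ 1 / σ * εg := by gcongr
        _ = _ := by ring
    calc modelDecrease ν KH 1 1 σm * min (εg ^ 2) (εH ^ 3)
        ≤ (1 / 4 * min (1 / KH) (Real.sqrt (1 / σm))) * εg ^ 2 :=
          mul_le_mul (min_le_left _ _) (min_le_left _ _) hmin0
            (mul_nonneg (by norm_num) (le_min (by positivity) (Real.sqrt_nonneg _)))
      _ = εg / 4 * (min (1 / KH) (Real.sqrt (1 / σm)) * εg) := by ring
      _ ≤ εg / 4 * min (εg / KH) (Real.sqrt (εg / σ)) := by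
          refine mul_le_mul_of_nonneg_left ?_ (by positivity)
          rw [min_mul_of_nonneg _ _ hg0.le]
          exact min_le_min (by rw [one_div_mul_eq_div]) h1
  · calc modelDecrease ν KH 1 1 σm * min (εg ^ 2) (εH ^ 3)
        ≤ (ν ^ 3 * 1 ^ 3 / (6 * σm ^ 2)) * εH ^ 3 :=
          mul_le_mul (min_le_right _ _) (min_le_right _ _) hmin0 (by positivity)
      _ = ν ^ 3 * εH ^ 3 / (6 * σm ^ 2) := by ring
      _ ≤ _ := by gcongr

end Descent

/-! ### Iteration complexity -/

section Complexity

theorem one_div_min {a b : ℝ} (ha : 0 < a) (hb : 0 < b) : 1 / min a b = max (1 / a) (1 / b) := by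
  rcases le_total a b with h | h
  · rw [min_eq_left h, max_eq_left (one_div_le_one_div_of_le ha h)]
  · rw [min_eq_right h, max_eq_right (one_div_le_one_div_of_le hb h)]

/-- Iteration complexity of adaptive cubic regularization with accurate Hessians. -/
theorem exists_iteration_bound (η γ ν L KH σ₀ Δ : ℝ) (hη : 0 < η ∧ η < 1) (hγ : 1 < γ)
    (hν : 0 < ν) (hL : 0 < L) (hKH : 0 < KH) (hσ₀ : 0 < σ₀) :
    ∃ C : ℝ, 1 ≤ C ∧ ∀ (d : ℕ) (F : Vec d → ℝ) (x₀ : Vec d) (_hF : TwiceDifferentiable F)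
      (_hΔ : ∀ y, F x₀ - F y ≤ Δ) (εg εH ε : ℝ) (_hεg : 0 < εg ∧ εg < 1)
      (_hεH : 0 < εH ∧ εH < 1) (_hε : 0 < ε ∧ ε ≤ maxTolerance η ν L KH εg εH)
      (H : ℕ → Vec d →L[ℝ] Vec d) (x : ℕ → Vec d) (σ : ℕ → ℝ) (s : ℕ → Vec d)
      (_hrun : IsARCRun F εg εH η γ x₀ σ₀ H x σ s)
      (_hdesc : StepsDescend F εg εH ν KH H x σ s)
      (_hLip : HessianLipschitzOnPath F εg εH L H x s) (N : ℕ)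
      (_hcont : ∀ t ≤ N, ¬ Stops F εg εH (x t) (H t))
      (_hclose : ∀ t ≤ N, ‖H t - hess F (x t)‖ ≤ ε),
      (N : ℝ) + 2 ≤ C * max (1 / εg ^ 2) (1 / εH ^ 3) := by
  -- A rejection happens only below `2L` and multiplies `σ` by `γ`, so `σ` never exceeds `σm`.
  set σm := max σ₀ (2 * γ * L) with hσm
  have hσm0 : 0 < σm := hσ₀.trans_le (le_max_left _ _)
  set c := modelDecrease ν KH 1 1 σm with hc
  have hc0 : 0 < c := modelDecrease_pos hν hKH one_pos one_pos hσm0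
  have hlγ : 0 < Real.log γ := Real.log_pos hγ
  have hγ0 : 0 < γ := by linarith
  have hlog0 : 0 ≤ Real.log (σm / σ₀) / Real.log γ := by
    refine div_nonneg (Real.log_nonneg ?_) hlγ.le
    rw [le_div_iff₀ hσ₀, one_mul]
    exact le_max_left _ _
  have hη0 := hη.1
  -- `|Δ|` keeps the constant at least `1` for any real `Δ`; the final `1` turns the bound on `N +
  -- 1` into one on `N + 2`.
  refine ⟨2 * |Δ| / (η * c) + Real.log (σm / σ₀) / Real.log γ + 1, ?_, ?_⟩
  · have : 0 ≤ 2 * |Δ| / (η * c) := by positivity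
    linarith
  intro d F x₀ hF hΔ εg εH ε hεg hεH hε H x σ s hrun hdesc hLip N hcont hclose
  have hg0 := hεg.1
  have hH0 := hεH.1
  set M := min (εg ^ 2) (εH ^ 3) with hM
  have hM0 : 0 < M := lt_min (by positivity) (by positivity)
  have hM1 : M ≤ 1 := (min_le_left _ _).trans (pow_le_one₀ hg0.le hεg.2.le)
  rw [← one_div_min (by positivity) (by positivity), ← hM]
  have hD0 : 0 < η * (c * M) := by positivity
  -- The right side is a potential that grows by at least one per iteration. A rejection raises the
  -- logarithm by one; an acceptance lowers it by one but raises the decrease term by at least two.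
  have key : ∀ t ≤ N + 1, 0 < σ t ∧ σ t ≤ σm ∧
      (t : ℝ) ≤ Real.log (σ t / σ₀) / Real.log γ + 2 * (F x₀ - F (x t)) / (η * (c * M)) := by
    intro t
    induction t with
    | zero =>
      intro _
      rw [hrun.x_zero, hrun.σ_zero]
      refine ⟨hσ₀, le_max_left _ _, ?_⟩
      simp [div_self hσ₀.ne']
    | succ t ih =>
      intro ht
      have htN : t ≤ N := Nat.le_of_succ_le_succ ht
      obtain ⟨h1, h2, h3⟩ := ih (htN.trans (Nat.le_succ N))
      have hns : ∀ k ≤ t, ¬ Stops F εg εH (x k) (H k) := fun k hk => hcont k (hk.trans htN)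
      have hmd := modelDecrease_le hν hKH hg0 hH0 h1 (hdesc t hns) (hns t le_rfl)
      have hmp := modelDecrease_pos hν hKH hg0 hH0 h1
      have hcm : c * M ≤ modelDecrease ν KH εg εH (σ t) :=
        le_modelDecrease hν hKH hεg hH0 h1 h2
      by_cases hacc : η ≤ decreaseRatio F (x t) (H t) (σ t) (s t)
      · obtain ⟨hx, hs⟩ := hrun.accept t hns hacc
        rw [hx, hs]
        have hle : σ t / γ ≤ σ t := div_le_self h1.le hγ.le
        refine ⟨by positivity, hle.trans h2, ?_⟩
        unfold decreaseRatio at hacc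
        rw [le_div_iff₀ (hmp.trans_le hmd)] at hacc
        have hdec : η * (c * M) ≤ F (x t) - F (x t + s t) :=
          (mul_le_mul_of_nonneg_left (hcm.trans hmd) hη0.le).trans hacc
        have h4 : 2 * (F x₀ - F (x t)) / (η * (c * M)) + 2 ≤
            2 * (F x₀ - F (x t + s t)) / (η * (c * M)) := by
          rw [div_add' _ _ _ hD0.ne']
          refine div_le_div_of_nonneg_right ?_ hD0.le
          linarith
        have h5 : Real.log (σ t / γ / σ₀) / Real.log γ =
            Real.log (σ t / σ₀) / Real.log γ - 1 := by
          rw [div_right_comm, Real.log_div (by positivity) hγ0.ne', sub_div, div_self hlγ.ne']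
        rw [h5]
        push_cast
        linarith
      · have hσL : σ t < 2 * L := by
          by_contra hcon
          push Not at hcon
          refine hacc (eta_le_decreaseRatio hF _ _ _ h1 hcon hε.1.le (hclose t htN)
            (hLip t hns) hmp hmd hη.2.le ?_)
          exact tolerance_cubed_le hη0 hη.2 hν hL hKH hg0 hH0 hcon hε.1 hε.2
        obtain ⟨hx, hs⟩ := hrun.reject t hns (not_le.1 hacc)
        rw [hx, hs]
        refine ⟨by positivity, le_trans ?_ (le_max_right _ _), ?_⟩
        · have := mul_le_mul_of_nonneg_left hσL.le hγ0.le
          linarith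
        · have h5 : Real.log (γ * σ t / σ₀) / Real.log γ =
              Real.log (σ t / σ₀) / Real.log γ + 1 := by
            rw [mul_div_assoc, Real.log_mul hγ0.ne' (by positivity), add_div, div_self hlγ.ne',
              add_comm]
          rw [h5]
          push_cast
          linarith
  obtain ⟨h1, h2, h3⟩ := key (N + 1) le_rfl
  have h4 : Real.log (σ (N + 1) / σ₀) / Real.log γ ≤ Real.log (σm / σ₀) / Real.log γ := by
    refine div_le_div_of_nonneg_right (Real.log_le_log (by positivity) (by gcongr)) hlγ.le
  have h5 : 2 * (F x₀ - F (x (N + 1))) / (η * (c * M)) ≤ 2 * |Δ| / (η * c) * (1 / M) := by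
    rw [div_mul_div_comm, mul_one, mul_assoc]
    refine div_le_div_of_nonneg_right ?_ hD0.le
    linarith [hΔ (x (N + 1)), le_abs_self Δ]
  have h6 : 1 ≤ 1 / M := by rwa [le_div_iff₀ hM0, one_mul]
  have h7 : Real.log (σm / σ₀) / Real.log γ + 1 ≤
      (Real.log (σm / σ₀) / Real.log γ + 1) * (1 / M) :=
    le_mul_of_one_le_right (by linarith) h6
  push_cast at h3
  linarith

end Complexity

/-! ### Conditional failure probability -/

section Conditional

open Classical in
/-- If `S` has conditional law `law X` given `𝓖` on the event `A`, and the bad values of `S` have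
conditional probability at most `δ`, then so has the event that `A` holds and `S` is bad. -/
theorem measureReal_bad_le {Ω V ι : Type*} {𝓖 mΩ : MeasurableSpace Ω} [MeasurableSpace V]
    [Fintype ι] (μ : Measure Ω) [IsProbabilityMeasure μ] (h𝓖 : 𝓖 ≤ mΩ)
    {A : Set Ω} (hA : MeasurableSet[𝓖] A) {X : Ω → V} (hX : Measurable[𝓖] X) {S : Ω → ι}
    (hS : ∀ J, MeasurableSet {ω | S ω = J}) (bad : V → ι → Prop)
    (hbad : ∀ J, MeasurableSet {v | bad v J}) (law : V → ι → ℝ) {δ : ℝ} (hδ : 0 ≤ δ)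
    (hcond : ∀ J, ∀ᵐ ω ∂μ, ω ∈ A →
      (μ[({ω' | S ω' = J} : Set Ω).indicator (fun _ => (1 : ℝ)) | 𝓖]) ω = law (X ω) J)
    (htail : ∀ v, ∑ J, (if bad v J then law v J else 0) ≤ δ) :
    μ.real {ω | ω ∈ A ∧ bad (X ω) (S ω)} ≤ δ := by
  set φ : ι → Ω → ℝ := fun J =>
    μ[({ω' | S ω' = J} : Set Ω).indicator (fun _ => (1 : ℝ)) | 𝓖] with hφ
  set B : ι → Set Ω := fun J => A ∩ X ⁻¹' {v | bad v J} with hB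
  have hBm : ∀ J, MeasurableSet[𝓖] (B J) := fun J => hA.inter (hX (hbad J))
  have h1 : {ω | ω ∈ A ∧ bad (X ω) (S ω)} ⊆ ⋃ J ∈ (Finset.univ : Finset ι),
      (B J ∩ {ω | S ω = J}) := by
    rintro ω ⟨hω, hb⟩
    simp only [Set.mem_iUnion]
    exact ⟨S ω, Finset.mem_univ _, ⟨hω, hb⟩, rfl⟩
  -- For fixed `J` the set `B J` is known given `𝓖`, so the indicator of `S = J` may be replaced by
  -- its conditional expectation. Summing over `J` then allows the tail bound to be applied
  -- pointwise.
  have h2 : ∀ J, μ.real (B J ∩ {ω | S ω = J}) = ∫ ω, (B J).indicator (φ J) ω ∂μ := by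
    intro J
    rw [integral_indicator (h𝓖 _ (hBm J)), hφ]
    rw [setIntegral_condExp h𝓖 ((integrable_const (1 : ℝ)).indicator (hS J)) (hBm J),
      setIntegral_indicator (hS J)]
    simp
  have hint : ∀ J, Integrable ((B J).indicator (φ J)) μ := fun J =>
    integrable_condExp.indicator (h𝓖 _ (hBm J))
  calc μ.real {ω | ω ∈ A ∧ bad (X ω) (S ω)}
      ≤ μ.real (⋃ J ∈ (Finset.univ : Finset ι), (B J ∩ {ω | S ω = J})) := measureReal_mono h1 (measure_ne_top _ _)
    _ ≤ ∑ J, μ.real (B J ∩ {ω | S ω = J}) := measureReal_biUnion_finset_le _ _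
    _ = ∫ ω, ∑ J, (B J).indicator (φ J) ω ∂μ := by
        rw [integral_finsetSum _ fun J _ => hint J]
        exact Finset.sum_congr rfl fun J _ => h2 J
    _ ≤ ∫ _, δ ∂μ := by
        refine integral_mono_ae (integrable_finsetSum _ fun J _ => hint J) (integrable_const δ) ?_
        filter_upwards [ae_all_iff.2 hcond] with ω hω
        by_cases hωA : ω ∈ A
        · refine le_of_eq_of_le (Finset.sum_congr rfl fun J _ => ?_) (htail (X ω))
          by_cases hb : bad (X ω) J
          · rw [if_pos hb, Set.indicator_of_mem (show ω ∈ B J from ⟨hωA, hb⟩)]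
            exact hω J hωA
          · rw [if_neg hb, Set.indicator_of_notMem (fun h : ω ∈ B J => hb h.2)]
        · refine le_of_eq_of_le (Finset.sum_eq_zero fun J _ => ?_) hδ
          exact Set.indicator_of_notMem (fun h : ω ∈ B J => hωA h.1) _
    _ = δ := by simp

end Conditional

/-! ### Measurability of the stopping and tolerance tests -/

section Measurability

variable {d n m : ℕ}

theorem measurable_hess (F : Vec d → ℝ) : Measurable (hess F) :=
  measurable_fderiv ℝ (gradient F)

theorem measurable_subsampledHess (f : Fin n → Vec d → ℝ) {p : Vec d → Fin n → ℝ}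
    (hp : ∀ i, Measurable fun x => p x i) (J : Fin m → Fin n) :
    Measurable fun x => subsampledHess f (p x) J x := by
  unfold subsampledHess
  have h : Measurable fun x => ∑ k, (1 / p x (J k)) • hess (f (J k)) x :=
    Finset.measurable_fun_sum _ fun k _ =>
      (measurable_const.div (hp (J k))).smul (measurable_hess _)
  exact h.const_smul (1 / ((n : ℝ) * (m : ℝ)))

theorem continuous_lambdaMin (hd : 0 < d) :
    Continuous (lambdaMin : (Vec d →L[ℝ] Vec d) → ℝ) := by
  refine (LipschitzWith.of_le_add fun A B => ?_).continuous
  rw [dist_eq_norm]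
  exact lambdaMin_le_add hd A B

theorem measurableSet_stops (hd : 0 < d) {F : Vec d → ℝ} (hF : TwiceDifferentiable F)
    (f : Fin n → Vec d → ℝ) {p : Vec d → Fin n → ℝ} (hp : ∀ i, Measurable fun x => p x i)
    (εg εH : ℝ) (J : Fin m → Fin n) :
    MeasurableSet {x | Stops F εg εH x (subsampledHess f (p x) J x)} := by
  refine MeasurableSet.inter ?_ ?_
  · exact measurableSet_le hF.2.continuous.measurable.norm measurable_const
  · exact measurableSet_le measurable_const
      ((continuous_lambdaMin hd).measurable.comp (measurable_subsampledHess f hp J))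

theorem measurableSet_tolerance (F : Vec d → ℝ)
    (f : Fin n → Vec d → ℝ) {p : Vec d → Fin n → ℝ} (hp : ∀ i, Measurable fun x => p x i)
    (ε : ℝ) (J : Fin m → Fin n) :
    MeasurableSet {x | ε < ‖subsampledHess f (p x) J x - hess F x‖} :=
  measurableSet_lt measurable_const
    ((measurable_subsampledHess f hp J).sub (measurable_hess F)).norm

theorem IsUniformSampling.measurable_weights {K : Fin n → ℝ} {KH ε δ₀ : ℝ}
    {p : Vec d → Fin n → ℝ} {law : Vec d → (Fin m → Fin n) → ℝ}
    (h : IsUniformSampling m K KH ε δ₀ p law) (i : Fin n) : Measurable fun x => p x i := by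
  simp only [h.1]
  exact measurable_const

theorem IsNonuniformSampling.measurable_weights {f : Fin n → Vec d → ℝ}
    (hf : ∀ i, TwiceDifferentiable (f i)) {K : Fin n → ℝ} {KH ε δ₀ : ℝ}
    {p : Vec d → Fin n → ℝ} {law : Vec d → (Fin m → Fin n) → ℝ}
    (h : IsNonuniformSampling m f K KH ε δ₀ p law) (i : Fin n) : Measurable fun x => p x i := by
  obtain ⟨a, g, hfg, hp, -⟩ := h
  simp only [hp, curvatureWeights_eq hf a g hfg]
  have hs : Measurable fun x => ∑ j, ‖hess (f j) x‖ :=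
    Finset.measurable_fun_sum _ fun j _ => (measurable_hess (f j)).norm
  exact Measurable.ite (hs (measurableSet_singleton 0)) measurable_const
    ((measurable_hess (f i)).norm.div hs)

end Measurability

/-! ### Failure probability of one iteration -/

section Probability

variable {d n m : ℕ}

/-- In each iteration, the probability that the algorithm is still running and the sub-sampled
Hessian misses the tolerance is at most `δ₀`. -/
theorem IsSampled.measureReal_miss_le {Ω : Type*} {mΩ : MeasurableSpace Ω} {μ : Measure Ω}
    [IsProbabilityMeasure μ] {ℱ : Filtration ℕ mΩ} (hd : 0 < d) {f : Fin n → Vec d → ℝ}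
    (hf : ∀ i, TwiceDifferentiable (f i)) {εg εH ε δ₀ : ℝ} (hδ : 0 ≤ δ₀)
    {p : Vec d → Fin n → ℝ} (hp : ∀ i, Measurable fun x => p x i)
    {law : Vec d → (Fin m → Fin n) → ℝ} (htail : HasSamplingTail f ε δ₀ p law)
    {S : ℕ → Ω → Fin m → Fin n} {x : ℕ → Ω → Vec d}
    (hS : IsSampled μ ℱ f εg εH p law S x) (t : ℕ) :
    μ.real {ω | (∀ k < t, ¬ Stops (finiteSum f) εg εH (x k ω)
        (subsampledHess f (p (x k ω)) (S k ω) (x k ω))) ∧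
      ε < ‖subsampledHess f (p (x t ω)) (S t ω) (x t ω) - hess (finiteSum f) (x t ω)‖} ≤ δ₀ := by
  have hF := twiceDifferentiable_finiteSum hf
  have hA : MeasurableSet[ℱ t] {ω | ∀ k < t, ¬ Stops (finiteSum f) εg εH (x k ω)
        (subsampledHess f (p (x k ω)) (S k ω) (x k ω))} := by
    -- Splitting over the finitely many samples `J` makes the event of still running depend on `x k`
    -- and `S k` separately; both are known at time `t` when `k < t`.
    have : {ω | ∀ k < t, ¬ Stops (finiteSum f) εg εH (x k ω)
        (subsampledHess f (p (x k ω)) (S k ω) (x k ω))} = ⋂ k ∈ Set.Iio t,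
        ⋂ J : Fin m → Fin n, (S k ⁻¹' {J} ∩
          x k ⁻¹' {v | Stops (finiteSum f) εg εH v (subsampledHess f (p v) J v)})ᶜ := by
      ext ω
      simp
    rw [this]
    refine MeasurableSet.biInter (Set.to_countable _) fun k hk => MeasurableSet.iInter fun J => ?_
    refine (MeasurableSet.inter ?_ ?_).compl
    · exact ℱ.mono (Nat.succ_le_of_lt hk) _ (hS.S_meas k (measurableSet_singleton J))
    · exact ℱ.mono (le_of_lt hk) _ (hS.x_meas k (measurableSet_stops hd hF f hp εg εH J))
  exact measureReal_bad_le μ (ℱ.le t) hA (hS.x_meas t)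
    (fun J => ℱ.le (t + 1) _ (hS.S_meas t (measurableSet_singleton J)))
    (fun v J => ε < ‖subsampledHess f (p v) J v - hess (finiteSum f) v‖)
    (measurableSet_tolerance (finiteSum f) f hp ε) law hδ (hS.cond_law t)
    (fun v => le_of_eq_of_le (by congr!) (htail v))

end Probability

end SubsampledARC

/-! ### The main theorem -/

theorem mainTheorem7
    (η γ ν L KH σ₀ Δ : ℝ) (hη : 0 < η ∧ η < 1) (hγ : 1 < γ) (hν : 0 < ν ∧ ν ≤ 1)
    (hL : 0 < L) (hKH : 0 < KH) (hσ₀ : 0 < σ₀) :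
    ∃ C : ℝ, 1 ≤ C ∧
      ∀ (d n m : ℕ) (_hd : 0 < d) (_hn : 0 < n) (_hm : 0 < m)
        (f : Fin n → SubsampledARC.Vec d → ℝ) (K : Fin n → ℝ) (x₀ : SubsampledARC.Vec d)
        (_hf : ∀ i, SubsampledARC.TwiceDifferentiable (f i))
        (_hK : ∀ i x, ‖SubsampledARC.hess (f i) x‖ ≤ K i)
        (_hΔ : ∀ y, SubsampledARC.finiteSum f x₀ - SubsampledARC.finiteSum f y ≤ Δ)
        (εg εH δ ε δ₀ : ℝ) (_hεg : 0 < εg ∧ εg < 1) (_hεH : 0 < εH ∧ εH < 1)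
        (_hδ : 0 < δ ∧ δ < 1)
        (_hε : 0 < ε ∧ ε ≤ SubsampledARC.maxTolerance η ν L KH εg εH)
        (p : SubsampledARC.Vec d → Fin n → ℝ)
        (law : SubsampledARC.Vec d → (Fin m → Fin n) → ℝ)
        (_hsampling : SubsampledARC.IsUniformSampling m K KH ε δ₀ p law ∨
          SubsampledARC.IsNonuniformSampling m f K KH ε δ₀ p law)
        (Ω : Type*) (mΩ : MeasurableSpace Ω) (μ : MeasureTheory.Measure Ω)
        (_hμ : MeasureTheory.IsProbabilityMeasure μ) (ℱ : MeasureTheory.Filtration ℕ mΩ)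
        (S : ℕ → Ω → Fin m → Fin n) (x : ℕ → Ω → SubsampledARC.Vec d)
        (σ : ℕ → Ω → ℝ) (s : ℕ → Ω → SubsampledARC.Vec d)
        (_hS : SubsampledARC.IsSampled μ ℱ f εg εH p law S x)
        (_hrun : ∀ᵐ ω ∂μ, SubsampledARC.IsARCRun (SubsampledARC.finiteSum f) εg εH η γ x₀ σ₀
          (fun t => SubsampledARC.subsampledHess f (p (x t ω)) (S t ω) (x t ω))
          (fun t => x t ω) (fun t => σ t ω) (fun t => s t ω))
        (_hdesc : ∀ᵐ ω ∂μ, SubsampledARC.StepsDescend (SubsampledARC.finiteSum f) εg εH ν KH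
          (fun t => SubsampledARC.subsampledHess f (p (x t ω)) (S t ω) (x t ω))
          (fun t => x t ω) (fun t => σ t ω) (fun t => s t ω))
        (_hLip : ∀ᵐ ω ∂μ, SubsampledARC.HessianLipschitzOnPath (SubsampledARC.finiteSum f)
          εg εH L
          (fun t => SubsampledARC.subsampledHess f (p (x t ω)) (S t ω) (x t ω))
          (fun t => x t ω) (fun t => s t ω)),
        (δ₀ = δ * min (εg ^ 2) (εH ^ 3) →
          1 - C * δ ≤ μ.real (SubsampledARC.goodEvent f εg εH ε
            (C * max (1 / εg ^ 2) (1 / εH ^ 3)) p S x)) ∧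
        (δ₀ = δ * min (εg ^ 2) (εH ^ 3) / C →
          1 - δ ≤ μ.real (SubsampledARC.goodEvent f εg εH ε
            (C * max (1 / εg ^ 2) (1 / εH ^ 3)) p S x)) := by
  obtain ⟨C, hC1, hC⟩ := SubsampledARC.exists_iteration_bound η γ ν L KH σ₀ Δ hη hγ hν.1 hL hKH hσ₀
  refine ⟨C, hC1, ?_⟩
  intro d n m hd hn hm f K x₀ hf hK hΔ εg εH δ ε δ₀ hεg hεH hδ hε p law hsamp Ω mΩ μ hμ ℱ S x σ s
    hS hrun hdesc hLip
  have hg0 := hεg.1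
  have hH0 := hεH.1
  have hd0 := hδ.1
  have hM0 : 0 < min (εg ^ 2) (εH ^ 3) := lt_min (by positivity) (by positivity)
  have hM1 : min (εg ^ 2) (εH ^ 3) ≤ 1 := (min_le_left _ _).trans (pow_le_one₀ hg0.le hεg.2.le)
  have hmax : max (1 / εg ^ 2) (1 / εH ^ 3) = 1 / min (εg ^ 2) (εH ^ 3) :=
    (SubsampledARC.one_div_min (by positivity) (by positivity)).symm
  set T := C * max (1 / εg ^ 2) (1 / εH ^ 3) with hT
  have hT1 : 1 ≤ T := by
    rw [hT, hmax]
    exact one_le_mul_of_one_le_of_one_le hC1 (by rwa [le_div_iff₀ hM0, one_mul])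
  -- Both claims are this bound, since `T * δ₀` is `C * δ` in the first case and `δ` in the second.
  have key : 0 < δ₀ → δ₀ ≤ 1 →
      1 - T * δ₀ ≤ μ.real (SubsampledARC.goodEvent f εg εH ε T p S x) := by
    intro hδ0 hδ1
    have htail : SubsampledARC.HasSamplingTail f ε δ₀ p law :=
      hsamp.elim (fun h => h.hasSamplingTail hd hn hm hf hK hε.1 hδ0 hδ1)
        (fun h => h.hasSamplingTail hd hm hf hK hε.1 hδ0 hδ1)
    have hp : ∀ i, Measurable fun x => p x i := fun i =>
      hsamp.elim (fun h => h.measurable_weights i) (fun h => h.measurable_weights hf i)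
    set B : ℕ → Set Ω := fun t => {ω | (∀ k < t, ¬ SubsampledARC.Stops
        (SubsampledARC.finiteSum f) εg εH (x k ω)
        (SubsampledARC.subsampledHess f (p (x k ω)) (S k ω) (x k ω))) ∧
      ε < ‖SubsampledARC.subsampledHess f (p (x t ω)) (S t ω) (x t ω) -
        SubsampledARC.hess (SubsampledARC.finiteSum f) (x t ω)‖} with hB
    have hBle : ∀ t, μ.real (B t) ≤ δ₀ := hS.measureReal_miss_le hd hf hδ0.le hp htail
    set N := ⌊T⌋₊ with hN
    have hN1 : 1 ≤ N := Nat.le_floor (by exact_mod_cast hT1)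
    have hNT : (N : ℝ) ≤ T := Nat.floor_le (by linarith)
    -- `Z` collects the outcomes where one of the almost sure assumptions on the run fails.
    obtain ⟨Z, hZ, hZ0⟩ : ∃ Z : Set Ω, (∀ ω ∉ Z, ω ∉ ⋃ t ∈ Finset.range N, B t →
        ω ∈ SubsampledARC.goodEvent f εg εH ε T p S x) ∧ μ.real Z = 0 := by
      have hae := hrun.and (hdesc.and hLip)
      refine ⟨_, fun ω hω hωB => ?_, by rw [measureReal_def, ae_iff.1 hae, ENNReal.toReal_zero]⟩
      obtain ⟨h1, h2, h3⟩ := not_not.1 hω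
      have hclose : ∀ t < N, (∀ k < t, ¬ SubsampledARC.Stops
          (SubsampledARC.finiteSum f) εg εH (x k ω)
          (SubsampledARC.subsampledHess f (p (x k ω)) (S k ω) (x k ω))) →
          ‖SubsampledARC.subsampledHess f (p (x t ω)) (S t ω) (x t ω) -
            SubsampledARC.hess (SubsampledARC.finiteSum f) (x t ω)‖ ≤ ε := by
        intro t ht hact
        by_contra hcon
        refine hωB ?_
        simp only [Set.mem_iUnion]
        exact ⟨t, Finset.mem_range.2 ht, hact, not_le.1 hcon⟩
      have hex : ∃ t, t < N ∧ SubsampledARC.Stops (SubsampledARC.finiteSum f) εg εH (x t ω)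
          (SubsampledARC.subsampledHess f (p (x t ω)) (S t ω) (x t ω)) := by
        by_contra! hcon
        -- Without a stop in iterations `0, …, N - 1`, the complexity bound at `N - 1` reads `N + 1
        -- ≤ T`, contradicting `T < ⌊T⌋ + 1`.
        have hlt : ∀ t ≤ N - 1, t < N := fun t ht => by omega
        have := hC d _ x₀ (SubsampledARC.twiceDifferentiable_finiteSum hf) hΔ εg εH ε hεg hεH hε
          _ _ _ _ h1 h2 h3 (N - 1) (fun t ht => hcon t (hlt t ht))
          (fun t ht => hclose t (hlt t ht) fun k hk => hcon k (hk.trans (hlt t ht)))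
        rw [Nat.cast_sub hN1, Nat.cast_one] at this
        have hfl := Nat.lt_floor_add_one T
        linarith
      classical
      obtain ⟨htN, hst⟩ := Nat.find_spec hex
      have hact : ∀ k < Nat.find hex, ¬ SubsampledARC.Stops
          (SubsampledARC.finiteSum f) εg εH (x k ω)
          (SubsampledARC.subsampledHess f (p (x k ω)) (S k ω) (x k ω)) := fun k hk hk' =>
        Nat.find_min hex hk ⟨hk.trans htN, hk'⟩
      refine ⟨Nat.find hex, ?_, hst, hact, hst.1, ?_⟩
      · refine le_trans ?_ hNT
        exact_mod_cast htN
      · have := SubsampledARC.lambdaMin_le_add hd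
          (SubsampledARC.subsampledHess f (p (x (Nat.find hex) ω)) (S (Nat.find hex) ω)
            (x (Nat.find hex) ω))
          (SubsampledARC.hess (SubsampledARC.finiteSum f) (x (Nat.find hex) ω))
        linarith [hclose _ htN hact, hst.2]
    -- Covering the whole space and using subadditivity bounds the good event from below without
    -- proving it, or `Z`, measurable.
    have hcover : (Set.univ : Set Ω) ⊆ SubsampledARC.goodEvent f εg εH ε T p S x ∪
        ((⋃ t ∈ Finset.range N, B t) ∪ Z) := by
      intro ω _
      by_cases h1 : ω ∈ Z
      · exact Or.inr (Or.inr h1)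
      by_cases h2 : ω ∈ ⋃ t ∈ Finset.range N, B t
      · exact Or.inr (Or.inl h2)
      · exact Or.inl (hZ ω h1 h2)
    have hB' : μ.real (⋃ t ∈ Finset.range N, B t) ≤ N * δ₀ := by
      refine (MeasureTheory.measureReal_biUnion_finset_le _ _).trans
        ((Finset.sum_le_sum fun t _ => hBle t).trans_eq ?_)
      simp
    have hcov := (MeasureTheory.measureReal_mono (μ := μ) hcover).trans
      (MeasureTheory.measureReal_union_le _ _)
    have hu := MeasureTheory.measureReal_union_le (μ := μ) (⋃ t ∈ Finset.range N, B t) Z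
    have h1 : μ.real Set.univ = 1 := by simp
    have h2 := mul_le_mul_of_nonneg_right hNT hδ0.le
    linarith
  have hCpos : 0 < C := by linarith
  constructor
  · intro h
    have hδ0 : 0 < δ₀ := by rw [h]; positivity
    have hδ1 : δ₀ ≤ 1 := by rw [h]; exact mul_le_one₀ hδ.2.le hM0.le hM1
    have hTδ : T * δ₀ = C * δ := by
      rw [h, hT, hmax]; field_simp
    rw [← hTδ]
    exact key hδ0 hδ1
  · intro h
    have hδ0 : 0 < δ₀ := by rw [h]; positivity
    have hδ1 : δ₀ ≤ 1 := by
      rw [h]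
      exact div_le_one_of_le₀ ((mul_le_one₀ hδ.2.le hM0.le hM1).trans hC1) hCpos.le
    have hTδ : T * δ₀ = δ := by
      rw [h, hT, hmax]; field_simp
    have := key hδ0 hδ1
    rwa [hTδ] at this
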